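/- For every $n\ge 1$ let $X_1,\dots,X_n$ be random vectors in $\mathbb{R}^{p}$, $p=p_n$, and $\varepsilon_1,\dots,\varepsilon_n$ real random variables (a triangular array; the dependence on $n$ is suppressed). Let $\rho:\mathbb{R}\to\mathbb{R}$ and $\tau>0$ be fixed, put $\psi=\rho'$, and let $$\hat\beta=\operatorname*{argmin}_{\beta\in\mathbb{R}^p}\ \frac1n\sum_{i=1}^n\rho(\varepsilon_i-X_i^{\top}\beta)+\frac{\tau}{2}\|\beta\|^2 .$$ Assume: 1. $p_n/n\to\kappa$ for some $\kappa\in(0,\infty)$. 2. $\rho$ is twice differentiable, convex and not affine, $\rho\ge 0$ and $\rho(0)=0$. 3. $\psi(|x|)=O(|x|^m)$ as $|x|\to\infty$ for some $m$; and for every $u$, $\psi'$ is Lipschitz on $(-|u|,|u|)$ with a constant $L(u)$ such that $L(|u|)\le K|u|^{m_1}$ for all sufficiently large $|u|$, for some $K,m_1$. 4. For each $n$, $X_1,\dots,X_n$ are i.i.d. with $\mathbb{E}X_i=0$ and $\operatorname{cov}(X_i)=\mathrm{Id}_p$. There are $C_n$ and $c_n>0$ such that for every $1$-Lipschitz convex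 $F:\mathbb{R}^p\to\mathbb{R}$ there is a deterministic number $m_F$ (e.g. the mean or a median of $F(X_i)$) with $P(|F(X_i)-m_F|>t)\le C_n\exp(-c_nt^2)$ for all $t>0$. Moreover $1/c_n=O((\log n)^{\alpha})$ and $C_n=O((\log n)^{\alpha'})$ for some $\alpha,\alpha'\ge 0$. 5. $\{X_i\}_{i=1}^n$ is independent of $\{\varepsilon_i\}_{i=1}^n$. 6. For every fixed $k$, $\frac1n\sum_{i=1}^n\mathbb{E}[\psi^{2k}(\varepsilon_i)]$ is bounded uniformly in $n$ (for all large $n$). 7. For each $n$, $\varepsilon_1,\dots,\varepsilon_n$ are independent, and $\sup_{1\le i\le n}|\varepsilon_i|=O((\log n)^{b})$ in $L_k$ for every fixed $k$, for some $b$ not depending on $k$ (this holds in particular if $\sup_i|\varepsilon_i|\le K(\log n)^b$ almost surely). Then $\|\hat\beta\|^2$ is square integrable for all large $n$ and $$\operatorname{Var}(\|\hat\beta\|^2)\to 0\quad\text{as } n\to\infty .$$ Consequently $\|\hat\beta\|^2$ has a deterministic equivalent in probability and in $L_2$: there are deterministic numbers $a_n$ with $\|\hat\beta\|^2-a_n\to0$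 in probability and in $L_2$. Moreover, since $1/c_n$ is at most of the order of a power of $\log n$, the variance has the rate $$\operatorname{Var}(\|\hat\beta\|^2)=O\!\left(\frac{(\log n)^{\gamma}}{n}\right)\quad\text{for some }\gamma .$$ -/

import Mathlib

open MeasureTheory ProbabilityTheory Filter Topology Asymptotics
open scoped NNReal ENNReal

/-- The ridge-regularized `M`-estimation objective
`β ↦ (1/n) ∑ i, ρ (e i - x iᵀ β) + (τ/2) ‖β‖²`. -/
noncomputable def ridgeObjective {n p : ℕ} (ρ : ℝ → ℝ) (τ : ℝ)
    (x : Fin n → EuclideanSpace ℝ (Fin p)) (e : Fin n → ℝ)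
    (β : EuclideanSpace ℝ (Fin p)) : ℝ :=
  (1 / (n : ℝ)) * ∑ i, ρ (e i - inner ℝ (x i) β) + τ / 2 * ‖β‖ ^ 2

/-- The ridge-regularized estimator: a minimizer of `ridgeObjective` over all of `ℝ^p`. For a
continuous convex `ρ ≥ 0` and `τ > 0` it exists and is unique, see `ridgeEstimator_isMin` and
`eq_ridgeEstimator_of_isMin`. -/
noncomputable def ridgeEstimator {n p : ℕ} (ρ : ℝ → ℝ) (τ : ℝ)
    (x : Fin n → EuclideanSpace ℝ (Fin p)) (e : Fin n → ℝ) : EuclideanSpace ℝ (Fin p) :=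
  Classical.epsilon fun β => ∀ b, ridgeObjective ρ τ x e β ≤ ridgeObjective ρ τ x e b

theorem ridgeEstimator_isMin {n p : ℕ} {ρ : ℝ → ℝ} {τ : ℝ} (hτ : 0 < τ) (hc : Continuous ρ)
    (h0 : ∀ u, 0 ≤ ρ u) (x : Fin n → EuclideanSpace ℝ (Fin p)) (e : Fin n → ℝ)
    (b : EuclideanSpace ℝ (Fin p)) :
    ridgeObjective ρ τ x e (ridgeEstimator ρ τ x e) ≤ ridgeObjective ρ τ x e b := by
  have hcont : Continuous (ridgeObjective ρ τ x e) := by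
    unfold ridgeObjective
    fun_prop
  have hlim : Tendsto (ridgeObjective ρ τ x e) (cocompact _) atTop := by
    have h1 : Tendsto (fun β : EuclideanSpace ℝ (Fin p) => τ / 2 * ‖β‖ ^ 2)
        (cocompact _) atTop :=
      Tendsto.const_mul_atTop (by positivity)
        ((tendsto_pow_atTop two_ne_zero).comp tendsto_norm_cocompact_atTop)
    refine tendsto_atTop_mono (fun β => ?_) h1
    have : 0 ≤ (1 / (n : ℝ)) * ∑ i, ρ (e i - inner ℝ (x i) β) :=
      mul_nonneg (by positivity) (Finset.sum_nonneg fun i _ => h0 _)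
    unfold ridgeObjective
    linarith
  exact Classical.epsilon_spec (p := fun β => ∀ b, ridgeObjective ρ τ x e β ≤
    ridgeObjective ρ τ x e b) (hcont.exists_forall_le hlim) b

theorem eq_ridgeEstimator_of_isMin {n p : ℕ} {ρ : ℝ → ℝ} {τ : ℝ} (hτ : 0 < τ)
    (hc : Continuous ρ) (h0 : ∀ u, 0 ≤ ρ u) (hconv : ConvexOn ℝ Set.univ ρ)
    (x : Fin n → EuclideanSpace ℝ (Fin p)) (e : Fin n → ℝ) (β : EuclideanSpace ℝ (Fin p))
    (hβ : ∀ b, ridgeObjective ρ τ x e β ≤ ridgeObjective ρ τ x e b) :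
    β = ridgeEstimator ρ τ x e := by
  set γ := ridgeEstimator ρ τ x e with hγ
  have hm := ridgeEstimator_isMin hτ hc h0 x e
  have e1 := hβ ((1 / 2 : ℝ) • β + (1 / 2 : ℝ) • γ)
  have e2 := hm ((1 / 2 : ℝ) • β + (1 / 2 : ℝ) • γ)
  rw [← hγ] at e2
  have hs : ∑ i, ρ (e i - inner ℝ (x i) ((1 / 2 : ℝ) • β + (1 / 2 : ℝ) • γ)) ≤
      (1 / 2) * ∑ i, ρ (e i - inner ℝ (x i) β) + (1 / 2) * ∑ i, ρ (e i - inner ℝ (x i) γ) := by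
    rw [Finset.mul_sum, Finset.mul_sum, ← Finset.sum_add_distrib]
    refine Finset.sum_le_sum fun i _ => ?_
    have := hconv.2 (Set.mem_univ (e i - inner ℝ (x i) β))
      (Set.mem_univ (e i - inner ℝ (x i) γ)) (show (0 : ℝ) ≤ 1 / 2 by norm_num)
      (show (0 : ℝ) ≤ 1 / 2 by norm_num) (by norm_num)
    simp only [smul_eq_mul] at this
    convert this using 2
    rw [inner_add_right, inner_smul_right, inner_smul_right]
    ring
  have hn := mul_le_mul_of_nonneg_left hs (show 0 ≤ 1 / (n : ℝ) by positivity)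
  have hpar := parallelogram_law_with_norm ℝ β γ
  have hmid : ‖(1 / 2 : ℝ) • β + (1 / 2 : ℝ) • γ‖ = (1 / 2) * ‖β + γ‖ := by
    rw [← smul_add, norm_smul]
    norm_num
  unfold ridgeObjective at e1 e2
  rw [hmid] at e1 e2
  have hle : τ * (‖β - γ‖ * ‖β - γ‖) ≤ 0 := by nlinarith
  have hz : ‖β - γ‖ = 0 := by
    have : ‖β - γ‖ * ‖β - γ‖ ≤ 0 := by
      by_contra h
      push Not at h
      exact absurd hle (not_le.mpr (mul_pos hτ h))
    nlinarith [norm_nonneg (β - γ)]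
  exact sub_eq_zero.mp (norm_eq_zero.mp hz)

/-- Assumptions on the loss `ρ`, with `ψ = ρ'`. -/
structure LossAssumptions (ρ : ℝ → ℝ) : Prop where
  differentiable : Differentiable ℝ ρ
  differentiable_deriv : Differentiable ℝ (deriv ρ)
  convex : ConvexOn ℝ Set.univ ρ
  nonlinear : ¬ ∃ a b : ℝ, ∀ u, ρ u = a * u + b
  nonneg : ∀ u, 0 ≤ ρ u
  map_zero : ρ 0 = 0
  /-- `ψ(|u|) = O(|u|^m)` as `|u| → ∞`, for some `m`. -/
  growth : ∃ m : ℝ, (fun u : ℝ => deriv ρ |u|) =O[cocompact ℝ] fun u => |u| ^ m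
  /-- `ψ'` is `L(u)`-Lipschitz on `(-|u|, |u|)`, where `L(|u|) ≤ K |u|^m₁` for large `|u|`. -/
  lipschitz : ∃ L : ℝ → ℝ≥0,
    (∀ u, LipschitzOnWith (L u) (deriv (deriv ρ)) (Set.Ioo (-|u|) |u|)) ∧
    ∃ K m₁ : ℝ, ∀ᶠ u in cocompact ℝ, (L |u| : ℝ) ≤ K * |u| ^ m₁

/-- The random vector `X` has the concentration property with constants `C`, `c`: every
`1`-Lipschitz convex function of `X` deviates from a suitable deterministic number `m` (such as its
mean or a median) by more than `t` with probability at most `C exp(-c t²)`. -/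
def ConvexConcentration {Ω : Type*} [MeasurableSpace Ω] {p : ℕ} (P : Measure Ω)
    (X : Ω → EuclideanSpace ℝ (Fin p)) (C c : ℝ) : Prop :=
  ∀ F : EuclideanSpace ℝ (Fin p) → ℝ, LipschitzWith 1 F → ConvexOn ℝ Set.univ F →
    ∃ m : ℝ, ∀ t : ℝ, 0 < t → P.real {ω | t < |F (X ω) - m|} ≤ C * Real.exp (-c * t ^ 2)

/-- Assumptions on the design vectors `X n 1, …, X n n` in `ℝ^(p n)`. -/
structure DesignAssumptions {Ω : ℕ → Type*} [∀ n, MeasurableSpace (Ω n)]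
    (P : ∀ n, Measure (Ω n)) (p : ℕ → ℕ)
    (X : ∀ n, Fin n → Ω n → EuclideanSpace ℝ (Fin (p n))) (C c : ℕ → ℝ) : Prop where
  measurable : ∀ n i, Measurable (X n i)
  indep : ∀ n, iIndepFun (X n) (P n)
  identDistrib : ∀ n i j, IdentDistrib (X n i) (X n j) (P n) (P n)
  mean_zero : ∀ n i j, ∫ ω, X n i ω j ∂(P n) = 0
  cov_id : ∀ n i j k, ∫ ω, X n i ω j * X n i ω k ∂(P n) = if j = k then 1 else 0
  concentration : ∀ n i, ConvexConcentration (P n) (X n i) (C n) (c n)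
  c_pos : ∀ n, 0 < c n
  /-- `1 / c n` grows at most like a power of `log n`. -/
  c_polylog : ∃ α : ℝ, 0 ≤ α ∧ (fun n => (c n)⁻¹) =O[atTop] fun n : ℕ => Real.log n ^ α
  /-- `C n` grows at most like a power of `log n`. -/
  C_polylog : ∃ α : ℝ, 0 ≤ α ∧ C =O[atTop] fun n : ℕ => Real.log n ^ α

/-- Assumptions on the errors `ε n 1, …, ε n n`, with `ψ = ρ'`. -/
structure ErrorAssumptions {Ω : ℕ → Type*} [∀ n, MeasurableSpace (Ω n)]
    (P : ∀ n, Measure (Ω n)) (ρ : ℝ → ℝ) (ε : ∀ n, Fin n → Ω n → ℝ) : Prop where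
  measurable : ∀ n i, Measurable (ε n i)
  indep : ∀ n, iIndepFun (ε n) (P n)
  /-- For each `k`, the average of `E[ψ(ε_i)^(2k)]` over `i` is bounded in `n`. -/
  moments : ∀ k : ℕ, ∃ M : ℝ, ∀ᶠ n in atTop,
    (∀ i, Integrable (fun ω => deriv ρ (ε n i ω) ^ (2 * k)) (P n)) ∧
    (1 / (n : ℝ)) * ∑ i, ∫ ω, deriv ρ (ε n i ω) ^ (2 * k) ∂(P n) ≤ M
  /-- `sup_i |ε_i|` is `O((log n)^b)` in every `L_k`. -/
  sup_polylog : ∃ b : ℝ, ∀ k : ℕ, ∃ K : ℝ, ∀ᶠ n : ℕ in atTop,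
    eLpNorm (fun ω => ⨆ i, |ε n i ω|) k (P n) ≤ ENNReal.ofReal (K * Real.log n ^ b)

/-- The random variable `‖β̂‖²` for sample size `n`. -/
noncomputable def estimatorSqNorm {Ω : ℕ → Type*} {p : ℕ → ℕ} (ρ : ℝ → ℝ) (τ : ℝ)
    (X : ∀ n, Fin n → Ω n → EuclideanSpace ℝ (Fin (p n))) (ε : ∀ n, Fin n → Ω n → ℝ)
    (n : ℕ) (ω : Ω n) : ℝ :=
  ‖ridgeEstimator ρ τ (fun i => X n i ω) (fun i => ε n i ω)‖ ^ 2

/-! The Efron–Stein inequality bounds the variance of `‖β̂‖²` by the sum over `i` of `E(‖β̂‖² -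
‖β̂₍ᵢ₎‖²)²`, where `β̂₍ᵢ₎` is computed with observation `i` deleted. It therefore suffices that
`n(‖β̂‖² - ‖β̂₍ᵢ₎‖²)` has moments polylogarithmic in `n`, uniformly in `i`: then `n` terms of size
`polylog / n²` add up to `polylog / n`.

The ridge term makes the gradient strongly monotone, so a point with small gradient is close to the
minimizer. This alone gives `‖β̂ - β̂₍ᵢ₎‖ ≈ n^(-1/2)`, which is too weak. The exact identity that
the deleted gradient at `β̂` equals `(ψ(rᵢ)/n) Xᵢ` suggests the finer approximation `β̂ ≈ β̂₍ᵢ₎ + w`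
with `w = (ψ(rᵢ)/n) H₍ᵢ₎⁻¹ Xᵢ`, where `H₍ᵢ₎` is the deleted Hessian at `β̂₍ᵢ₎`. Its error is
`O(1/n)` up to polylogarithmic factors (`norm_sampleEstimator_sub_expansion_sq_le`). Then `‖β̂‖² -
‖β̂₍ᵢ₎‖²` is `(2ψ(rᵢ)/n) ⟨Xᵢ, H₍ᵢ₎⁻¹ β̂₍ᵢ₎⟩` plus terms of order `1/n`
(`mul_abs_norm_sq_sub_norm_sq_le`).

The gain is probabilistic: `Xᵢ` is independent of `H₍ᵢ₎⁻¹ β̂₍ᵢ₎`, and a linear form in `Xᵢ` with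
independent coefficients is of the order of the norm of the coefficients, without a factor `√p`
(`ExpSqDesign.hasPolylogMoments_inner`). The factor `ψ(rᵢ)` does depend on `Xᵢ`, but `|rᵢ|` is at
most the residual at `β̂₍ᵢ₎` (`abs_sampleResidual_le`), which is again such a form. The expansion
error needs moments of `‖X‖²/n` for the design matrix `X`, obtained by a volume argument
(`lintegral_norm_designMap_pow_le`). -/

/-! ### Analytic bounds for the loss and its derivatives. -/

namespace LossAssumptions

variable {ρ : ℝ → ℝ}

theorem continuous (h : LossAssumptions ρ) : Continuous ρ := h.differentiable.continuous

theorem continuous_deriv (h : LossAssumptions ρ) : Continuous (deriv ρ) :=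
  h.differentiable_deriv.continuous

theorem deriv_map_zero (h : LossAssumptions ρ) : deriv ρ 0 = 0 :=
  IsLocalMin.deriv_eq_zero (Eventually.of_forall fun u => by rw [h.map_zero]; exact h.nonneg u)

theorem monotone_deriv (h : LossAssumptions ρ) : Monotone (deriv ρ) := fun x y hxy =>
  h.convex.monotoneOn_deriv (fun x _ => h.differentiable x) (Set.mem_univ x) (Set.mem_univ y) hxy

theorem deriv_deriv_nonneg (h : LossAssumptions ρ) (x : ℝ) : 0 ≤ deriv (deriv ρ) x :=
  h.monotone_deriv.deriv_nonneg

theorem mul_deriv_nonneg (h : LossAssumptions ρ) (u : ℝ) : 0 ≤ u * deriv ρ u := by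
  rcases le_total 0 u with hu | hu
  · exact mul_nonneg hu (h.deriv_map_zero ▸ h.monotone_deriv hu)
  · exact mul_nonneg_of_nonpos_of_nonpos hu (h.deriv_map_zero ▸ h.monotone_deriv hu)

theorem le_mul_deriv (h : LossAssumptions ρ) (u : ℝ) : ρ u ≤ u * deriv ρ u := by
  rcases lt_trichotomy 0 u with hu | rfl | hu
  · obtain ⟨c, hc, he⟩ := exists_deriv_eq_slope ρ hu h.continuous.continuousOn
      h.differentiable.differentiableOn
    have := h.monotone_deriv hc.2.le
    rw [he, h.map_zero, div_le_iff₀ (by linarith)] at this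
    linarith
  · simp [h.map_zero]
  · obtain ⟨c, hc, he⟩ := exists_deriv_eq_slope ρ hu h.continuous.continuousOn
      h.differentiable.differentiableOn
    have := h.monotone_deriv hc.1.le
    rw [he, h.map_zero, le_div_iff₀ (by linarith)] at this
    linarith

/-- Global form of the local Lipschitz condition on `ρ''`. -/
theorem exists_abs_deriv_deriv_sub_le (h : LossAssumptions ρ) :
    ∃ K : ℝ, 0 ≤ K ∧ ∃ q : ℕ, ∀ x y, |deriv (deriv ρ) x - deriv (deriv ρ) y| ≤
      K * (1 + |x| + |y|) ^ q * |x - y| := by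
  obtain ⟨L, hL, K, m, hK⟩ := h.lipschitz
  rw [cocompact_eq_atBot_atTop, eventually_sup] at hK
  obtain ⟨U, hU⟩ := eventually_atTop.1 hK.2
  refine ⟨|K| * (|U| + 1) ^ ⌈|m|⌉₊, by positivity, ⌈|m|⌉₊, fun x y => ?_⟩
  -- The summand `|U| + 1` puts `u` past the threshold `U`, makes the inclusion of `x` and `y`
  -- strict, and gives `u ≥ 1`, so that the real exponent can be rounded up.
  set u := |U| + 1 + |x| + |y| with hu
  have hx := abs_nonneg x
  have hy := abs_nonneg y
  have hUa := abs_nonneg U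
  have hu1 : 1 ≤ u := by linarith
  have hua : |u| = u := abs_of_nonneg (by linarith)
  have hmem : ∀ z, |z| < u → z ∈ Set.Ioo (-|u|) |u| := fun z hz => by
    rw [hua]; exact abs_lt.1 hz
  have hl := (hL u).dist_le_mul x (hmem x (by linarith)) y (hmem y (by linarith))
  rw [Real.dist_eq, Real.dist_eq] at hl
  have hb := hU u (by linarith [le_abs_self U])
  rw [hua] at hb
  refine hl.trans (mul_le_mul_of_nonneg_right ?_ (abs_nonneg _))
  calc (L u : ℝ) ≤ K * u ^ m := hb
    _ ≤ |K| * u ^ ((⌈|m|⌉₊ : ℕ) : ℝ) := by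
        gcongr
        · exact le_abs_self K
        · exact (le_abs_self m).trans (Nat.le_ceil _)
    _ ≤ |K| * ((|U| + 1) * (1 + |x| + |y|)) ^ ⌈|m|⌉₊ := by
        rw [Real.rpow_natCast]
        gcongr
        nlinarith
    _ = _ := by rw [mul_pow]; ring

theorem continuous_deriv_deriv (h : LossAssumptions ρ) : Continuous (deriv (deriv ρ)) := by
  obtain ⟨K, -, q, hK⟩ := h.exists_abs_deriv_deriv_sub_le
  rw [continuous_iff_continuousAt]
  intro y
  rw [ContinuousAt, tendsto_iff_dist_tendsto_zero]
  have h0 : Tendsto (fun x => K * (1 + |x| + |y|) ^ q * |x - y|) (𝓝 y) (𝓝 0) := by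
    have : Continuous fun x => K * (1 + |x| + |y|) ^ q * |x - y| := by fun_prop
    simpa using this.tendsto y
  exact squeeze_zero (fun _ => dist_nonneg) (fun x => hK x y) h0

/-- Mean value inequality for `ψ(y) - ψ'(r) y` on `[r - |t|, r + |t|]`, whose derivative `ψ'(y) -
ψ'(r)` is controlled by the local Lipschitz bound. The polynomial weight is harmless because all
moments will be available. -/
theorem exists_abs_deriv_sub_taylor_le (h : LossAssumptions ρ) :
    ∃ K : ℝ, 0 ≤ K ∧ ∃ q : ℕ, ∀ r t,
      |deriv ρ r - deriv ρ (r - t) - deriv (deriv ρ) r * t| ≤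
        K * (1 + 2 * |r| + |t|) ^ q * t ^ 2 := by
  obtain ⟨K, hK0, q, hK⟩ := h.exists_abs_deriv_deriv_sub_le
  refine ⟨K, hK0, q, fun r t => ?_⟩
  have hd : ∀ y, HasDerivAt (fun y => deriv ρ y - deriv (deriv ρ) r * y)
      (deriv (deriv ρ) y - deriv (deriv ρ) r) y := fun y => by
    simpa using (h.differentiable_deriv y).hasDerivAt.fun_sub
      ((hasDerivAt_id y).const_mul (deriv (deriv ρ) r))
  have hs := (convex_Icc (r - |t|) (r + |t|)).norm_image_sub_le_of_norm_hasDerivWithin_le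
    (x := r - t) (y := r) (C := K * (1 + 2 * |r| + |t|) ^ q * |t|)
    (fun y _ => (hd y).hasDerivWithinAt) (fun y hy => ?_)
    ⟨by linarith [le_abs_self t], by linarith [neg_abs_le t]⟩
    ⟨by linarith [abs_nonneg t], by linarith [abs_nonneg t]⟩
  · rw [Real.norm_eq_abs, Real.norm_eq_abs] at hs
    rw [show deriv ρ r - deriv ρ (r - t) - deriv (deriv ρ) r * t =
      deriv ρ r - deriv (deriv ρ) r * r - (deriv ρ (r - t) - deriv (deriv ρ) r * (r - t)) by ring]
    refine hs.trans (le_of_eq ?_)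
    rw [sub_sub_cancel, mul_assoc, ← sq, sq_abs]
  · have hyr : |y - r| ≤ |t| := abs_le.2 ⟨by linarith [hy.1], by linarith [hy.2]⟩
    have hy' : |y| ≤ |r| + |t| := by
      have := abs_add_le (y - r) r
      rw [sub_add_cancel] at this
      linarith
    rw [Real.norm_eq_abs]
    exact (hK y r).trans (mul_le_mul (mul_le_mul_of_nonneg_left
      (pow_le_pow_left₀ (by positivity) (by linarith) q) hK0) hyr (abs_nonneg _) (by positivity))

/-- This is the preceding Taylor bound at `r = 0`, where `ψ` vanishes. -/
theorem exists_abs_deriv_le (h : LossAssumptions ρ) :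
    ∃ K : ℝ, 0 ≤ K ∧ ∃ q : ℕ, ∀ x, |deriv ρ x| ≤ K * (1 + |x|) ^ q := by
  obtain ⟨K, hK0, q, hK⟩ := h.exists_abs_deriv_sub_taylor_le
  set D := |deriv (deriv ρ) 0|
  have hD : 0 ≤ D := abs_nonneg _
  refine ⟨D + K, by positivity, q + 2, fun x => ?_⟩
  have hx := hK 0 (-x)
  simp only [zero_sub, neg_neg, h.deriv_map_zero, abs_zero, mul_zero, add_zero, abs_neg] at hx
  have h1 : |deriv ρ x| ≤ D * |x| + K * (1 + |x|) ^ q * x ^ 2 := by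
    have h2 := abs_add_le (-deriv ρ x - deriv (deriv ρ) 0 * -x) (deriv (deriv ρ) 0 * -x)
    rw [sub_add_cancel, abs_neg, abs_mul (deriv (deriv ρ) 0), abs_neg] at h2
    rw [neg_sq] at hx
    linarith
  have hp : (1 : ℝ) ≤ (1 + |x|) ^ q := one_le_pow₀ (by linarith [abs_nonneg x])
  calc |deriv ρ x| ≤ D * |x| + K * (1 + |x|) ^ q * x ^ 2 := h1
    _ ≤ D * ((1 + |x|) ^ q * (1 + |x|) ^ 2) + K * (1 + |x|) ^ q * (1 + |x|) ^ 2 := by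
        have hx0 := abs_nonneg x
        refine add_le_add (mul_le_mul_of_nonneg_left ?_ hD) ?_
        · nlinarith [mul_le_mul_of_nonneg_right hp (sq_nonneg (1 + |x|))]
        · rw [← sq_abs x]
          gcongr
          linarith
    _ = _ := by ring

end LossAssumptions

/-! ### Deterministic stability of the estimator under deletion of an observation. -/

section Deterministic

variable {n p : ℕ}

/-- The ridge estimator as a function of the whole sample of pairs (design vector, error). -/
noncomputable def sampleEstimator (ρ : ℝ → ℝ) (τ : ℝ)
    (z : Fin n → EuclideanSpace ℝ (Fin p) × ℝ) : EuclideanSpace ℝ (Fin p) :=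
  ridgeEstimator ρ τ (fun i => (z i).1) (fun i => (z i).2)

/-- The gradient of the ridge objective. -/
noncomputable def ridgeGradient (ρ : ℝ → ℝ) (τ : ℝ)
    (z : Fin n → EuclideanSpace ℝ (Fin p) × ℝ) (b : EuclideanSpace ℝ (Fin p)) :
    EuclideanSpace ℝ (Fin p) :=
  τ • b - (1 / (n : ℝ)) • ∑ j, deriv ρ ((z j).2 - inner ℝ (z j).1 b) • (z j).1

/-- The residual of observation `j` at `b`. -/
noncomputable def sampleResidual (z : Fin n → EuclideanSpace ℝ (Fin p) × ℝ)
    (b : EuclideanSpace ℝ (Fin p)) (j : Fin n) : ℝ :=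
  (z j).2 - inner ℝ (z j).1 b

/-- The Hessian of the ridge objective. -/
noncomputable def ridgeHessian (ρ : ℝ → ℝ) (τ : ℝ)
    (z : Fin n → EuclideanSpace ℝ (Fin p) × ℝ) (b : EuclideanSpace ℝ (Fin p)) :
    EuclideanSpace ℝ (Fin p) →L[ℝ] EuclideanSpace ℝ (Fin p) :=
  τ • (1 : EuclideanSpace ℝ (Fin p) →L[ℝ] EuclideanSpace ℝ (Fin p)) + (1 / (n : ℝ)) •
    ∑ j, deriv (deriv ρ) (sampleResidual z b j) • (innerSL ℝ (z j).1).smulRight (z j).1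

/-- The design matrix as a continuous linear map. -/
noncomputable def designMap (x : Fin n → EuclideanSpace ℝ (Fin p)) :
    EuclideanSpace ℝ (Fin p) →L[ℝ] EuclideanSpace ℝ (Fin n) :=
  ∑ j, (innerSL ℝ (x j)).smulRight (EuclideanSpace.single j (1 : ℝ))

theorem continuous_smulRight {E F : Type*} [NormedAddCommGroup E] [NormedSpace ℝ E]
    [NormedAddCommGroup F] [NormedSpace ℝ F] :
    Continuous fun q : (E →L[ℝ] ℝ) × F => q.1.smulRight q.2 :=
  (ContinuousLinearMap.smulRightL ℝ E F).continuous₂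

theorem continuous_designMap : Continuous (designMap (n := n) (p := p)) := by
  unfold designMap
  refine continuous_finsetSum _ fun j _ => ?_
  exact continuous_smulRight.comp
    (((innerSL ℝ).continuous.comp (continuous_apply j)).prodMk continuous_const)

theorem designMap_apply (x : Fin n → EuclideanSpace ℝ (Fin p)) (v : EuclideanSpace ℝ (Fin p))
    (j : Fin n) : designMap x v j = inner ℝ (x j) v := by
  simp [designMap, Finset.sum_apply, Pi.single_apply]

theorem norm_designMap_sq (x : Fin n → EuclideanSpace ℝ (Fin p)) (v : EuclideanSpace ℝ (Fin p)) :
    ‖designMap x v‖ ^ 2 = ∑ j, inner ℝ (x j) v ^ 2 := by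
  rw [EuclideanSpace.norm_sq_eq]
  simp [designMap_apply]

/-- The bound `‖Aᵀ R‖ ≤ ‖A‖ ‖R‖`: Cauchy–Schwarz on `‖u‖² = ⟨R, A u⟩` with `u = Aᵀ R`, then division
by `‖u‖²`. -/
theorem norm_sum_smul_sq_le (x : Fin n → EuclideanSpace ℝ (Fin p)) (R : Fin n → ℝ) :
    ‖∑ j, R j • x j‖ ^ 2 ≤ ‖designMap x‖ ^ 2 * ∑ j, R j ^ 2 := by
  set u := ∑ j, R j • x j with hu
  have h1 : ‖u‖ ^ 2 = ∑ j, R j * inner ℝ (x j) u := by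
    rw [← real_inner_self_eq_norm_sq]
    nth_rewrite 1 [hu]
    simp [sum_inner, inner_smul_left]
  have h2 : (‖u‖ ^ 2) ^ 2 ≤ (∑ j, R j ^ 2) * ∑ j, inner ℝ (x j) u ^ 2 := by
    rw [h1]; exact Finset.sum_mul_sq_le_sq_mul_sq _ _ _
  rw [← norm_designMap_sq] at h2
  have h3 : ‖designMap x u‖ ^ 2 ≤ ‖designMap x‖ ^ 2 * ‖u‖ ^ 2 := by
    rw [← mul_pow]
    exact pow_le_pow_left₀ (norm_nonneg _) ((designMap x).le_opNorm u) 2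
  have hS : 0 ≤ ∑ j, R j ^ 2 := Finset.sum_nonneg fun j _ => sq_nonneg _
  rcases (sq_nonneg ‖u‖).eq_or_lt with h0 | h0
  · rw [← h0]; positivity
  · have h4 := h2.trans (mul_le_mul_of_nonneg_left h3 hS)
    rw [sq (‖u‖ ^ 2)] at h4
    refine le_of_mul_le_mul_right ?_ h0
    linarith

variable {ρ : ℝ → ℝ} {τ : ℝ}

theorem ridgeGradient_sampleEstimator (hρ : LossAssumptions ρ) (hτ : 0 < τ)
    (z : Fin n → EuclideanSpace ℝ (Fin p) × ℝ) :
    ridgeGradient ρ τ z (sampleEstimator ρ τ z) = 0 := by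
  set β := sampleEstimator ρ τ z with hβ
  -- The objective is differentiated along its own gradient `v`; the derivative at the minimum is
  -- `‖v‖²`, hence zero.
  set v := ridgeGradient ρ τ z β with hv
  have hlin : ∀ t : ℝ, HasDerivAt (fun t : ℝ => β + t • v) v t := fun t => by
    simpa using ((hasDerivAt_id t).smul_const v).const_add β
  have hd : HasDerivAt (fun t : ℝ => ridgeObjective ρ τ (fun i => (z i).1) (fun i => (z i).2)
      (β + t • v)) ((1 / (n : ℝ)) * ∑ i, deriv ρ ((z i).2 - inner ℝ (z i).1 β) *
        (-inner ℝ (z i).1 v) + τ / 2 * (2 * inner ℝ β v)) 0 := by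
    unfold ridgeObjective
    refine HasDerivAt.fun_add (HasDerivAt.const_mul _ (HasDerivAt.fun_sum fun i _ => ?_))
      (HasDerivAt.const_mul _ ?_)
    · have h1 : HasDerivAt (fun t : ℝ => (z i).2 - inner ℝ (z i).1 (β + t • v))
          (-inner ℝ (z i).1 v) 0 := by
        have := ((hasDerivAt_const (0 : ℝ) (z i).1).inner ℝ (hlin 0)).const_sub (z i).2
        simpa using this
      have h2 : HasDerivAt ρ (deriv ρ ((z i).2 - inner ℝ (z i).1 β))
          ((z i).2 - inner ℝ (z i).1 (β + (0 : ℝ) • v)) := by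
        simpa using (hρ.differentiable ((z i).2 - inner ℝ (z i).1 β)).hasDerivAt
      exact h2.comp 0 h1
    · simpa using (hlin 0).norm_sq
  have hmin : IsLocalMin (fun t : ℝ => ridgeObjective ρ τ (fun i => (z i).1) (fun i => (z i).2)
      (β + t • v)) 0 := Eventually.of_forall fun t => by
    simp only [zero_smul, add_zero]
    exact ridgeEstimator_isMin hτ hρ.continuous hρ.nonneg (fun i => (z i).1)
      (fun i => (z i).2) (β + t • v)
  have h0 := hmin.hasDerivAt_eq_zero hd
  rw [← inner_self_eq_zero (𝕜 := ℝ)]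
  rw [← h0]
  nth_rewrite 1 [hv]
  simp only [ridgeGradient, inner_sub_left, inner_smul_left, sum_inner, RCLike.conj_to_real]
  simp only [mul_neg, Finset.sum_neg_distrib]
  ring

/-- The ridge term contributes exactly `τ ‖b - c‖²`, and the loss contributes a nonnegative amount
since `ψ` is monotone. -/
theorem mul_norm_sub_sq_le_inner_ridgeGradient (hρ : LossAssumptions ρ)
    (z : Fin n → EuclideanSpace ℝ (Fin p) × ℝ) (b c : EuclideanSpace ℝ (Fin p)) :
    τ * ‖b - c‖ ^ 2 ≤ inner ℝ (ridgeGradient ρ τ z b - ridgeGradient ρ τ z c) (b - c) := by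
  have key : inner ℝ (ridgeGradient ρ τ z b - ridgeGradient ρ τ z c) (b - c) = τ * ‖b - c‖ ^ 2 +
      (1 / (n : ℝ)) * ∑ j, (deriv ρ (sampleResidual z b j) - deriv ρ (sampleResidual z c j)) *
        (sampleResidual z b j - sampleResidual z c j) := by
    have : ridgeGradient ρ τ z b - ridgeGradient ρ τ z c = τ • (b - c) - (1 / (n : ℝ)) •
        ∑ j, (deriv ρ (sampleResidual z b j) - deriv ρ (sampleResidual z c j)) • (z j).1 := by
      simp only [ridgeGradient, sampleResidual, sub_smul, Finset.sum_sub_distrib, smul_sub]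
      abel
    rw [this]
    simp only [inner_sub_left, inner_smul_left, sum_inner, RCLike.conj_to_real]
    rw [← inner_sub_left, real_inner_self_eq_norm_sq, sub_eq_add_neg, ← mul_neg,
      ← Finset.sum_neg_distrib]
    congr 2
    refine Finset.sum_congr rfl fun j _ => ?_
    simp only [sampleResidual, inner_sub_right]
    ring
  rw [key, le_add_iff_nonneg_right]
  refine mul_nonneg (by positivity) (Finset.sum_nonneg fun j _ => ?_)
  rcases le_total (sampleResidual z b j) (sampleResidual z c j) with h | h
  · exact mul_nonneg_of_nonpos_of_nonpos (sub_nonpos.2 (hρ.monotone_deriv h)) (sub_nonpos.2 h)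
  · exact mul_nonneg (sub_nonneg.2 (hρ.monotone_deriv h)) (sub_nonneg.2 h)

theorem mul_norm_sub_le_norm_ridgeGradient (hρ : LossAssumptions ρ)
    (z : Fin n → EuclideanSpace ℝ (Fin p) × ℝ) (b c : EuclideanSpace ℝ (Fin p)) :
    τ * ‖b - c‖ ≤ ‖ridgeGradient ρ τ z b - ridgeGradient ρ τ z c‖ := by
  have h := (mul_norm_sub_sq_le_inner_ridgeGradient (τ := τ) hρ z b c).trans
    (real_inner_le_norm _ _)
  rcases (norm_nonneg (b - c)).eq_or_lt with h0 | h0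
  · rw [← h0]; simp
  · refine le_of_mul_le_mul_right ?_ h0
    linarith

/-- The gradient of the perturbed problem at the old minimizer tends to zero and controls the
distance to the new one. Measurability of the estimator follows. -/
theorem continuous_sampleEstimator (hρ : LossAssumptions ρ) (hτ : 0 < τ) :
    Continuous (sampleEstimator (n := n) (p := p) ρ τ) := by
  rw [continuous_iff_continuousAt]
  intro z
  rw [ContinuousAt, tendsto_iff_norm_sub_tendsto_zero]
  have hψ := hρ.continuous_deriv
  have hc : Continuous fun y : Fin n → EuclideanSpace ℝ (Fin p) × ℝ => τ⁻¹ * ‖ridgeGradient ρ τ y (sampleEstimator ρ τ z)‖ := by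
    unfold ridgeGradient
    fun_prop
  have h0 := hc.tendsto z
  rw [ridgeGradient_sampleEstimator hρ hτ, norm_zero, mul_zero] at h0
  refine squeeze_zero (fun _ => norm_nonneg _) (fun y => ?_) h0
  have := mul_norm_sub_le_norm_ridgeGradient (τ := τ) hρ y (sampleEstimator ρ τ y)
    (sampleEstimator ρ τ z)
  rw [ridgeGradient_sampleEstimator hρ hτ, zero_sub, norm_neg] at this
  rwa [inv_mul_eq_div, le_div_iff₀' hτ]

/-- Comparison with the competitor `0`, dropping the nonnegative loss of the estimator. The design
does not enter. -/
theorem mul_norm_sampleEstimator_sq_le (hρ : LossAssumptions ρ) (hτ : 0 < τ)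
    (z : Fin n → EuclideanSpace ℝ (Fin p) × ℝ) :
    τ / 2 * ‖sampleEstimator ρ τ z‖ ^ 2 ≤ (1 / (n : ℝ)) * ∑ j, ρ (z j).2 := by
  have h := ridgeEstimator_isMin hτ hρ.continuous hρ.nonneg (fun i => (z i).1)
      (fun i => (z i).2) 0
  simp only [ridgeObjective, inner_zero_right, sub_zero, norm_zero] at h
  have h1 : 0 ≤ (1 / (n : ℝ)) * ∑ i, ρ ((z i).2 - inner ℝ (z i).1 (sampleEstimator ρ τ z)) :=
    mul_nonneg (by positivity) (Finset.sum_nonneg fun _ _ => hρ.nonneg _)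
  unfold sampleEstimator at h1 ⊢
  linarith

theorem sum_comp_update {α : Type*} {M : Type*} [AddCommGroup M] (z : Fin n → α) (i : Fin n)
    (y : α) (g : α → M) :
    ∑ j, g (Function.update z i y j) = ∑ j, g (z j) - g (z i) + g y := by
  rw [← Finset.add_sum_erase _ _ (Finset.mem_univ i),
    ← Finset.add_sum_erase _ (fun j => g (z j)) (Finset.mem_univ i)]
  have : ∑ j ∈ Finset.univ.erase i, g (Function.update z i y j) =
      ∑ j ∈ Finset.univ.erase i, g (z j) :=
    Finset.sum_congr rfl fun j hj => by rw [Function.update_of_ne (Finset.ne_of_mem_erase hj)]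
  rw [this, Function.update_self]
  abel

/-- Replacing a pair by `(0, 0)` removes its gradient term but keeps the factor `1/n`, so it acts as
deletion. The full estimator misses the deleted first-order equation by exactly this multiple of the
deleted design vector. -/
theorem ridgeGradient_update_sampleEstimator (hρ : LossAssumptions ρ) (hτ : 0 < τ)
    (z : Fin n → EuclideanSpace ℝ (Fin p) × ℝ) (i : Fin n) :
    ridgeGradient ρ τ (Function.update z i 0) (sampleEstimator ρ τ z) =
      (deriv ρ (sampleResidual z (sampleEstimator ρ τ z) i) / n) • (z i).1 := by
  have h := ridgeGradient_sampleEstimator hρ hτ z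
  simp only [ridgeGradient] at h ⊢
  rw [sum_comp_update z i 0
    (fun q => deriv ρ (q.2 - inner ℝ q.1 (sampleEstimator ρ τ z)) • q.1)]
  rw [sub_eq_zero] at h
  rw [h, sampleResidual]
  simp only [Prod.fst_zero, smul_zero, add_zero, smul_sub, sub_sub_cancel, smul_smul]
  congr 1
  ring

theorem mul_norm_sampleEstimator_sub_le (hρ : LossAssumptions ρ) (hτ : 0 < τ)
    (z : Fin n → EuclideanSpace ℝ (Fin p) × ℝ) (i : Fin n) :
    τ * ‖sampleEstimator ρ τ z - sampleEstimator ρ τ (Function.update z i 0)‖ ≤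
      |deriv ρ (sampleResidual z (sampleEstimator ρ τ z) i) / n| * ‖(z i).1‖ := by
  have h := mul_norm_sub_le_norm_ridgeGradient (τ := τ) hρ (Function.update z i 0)
    (sampleEstimator ρ τ z) (sampleEstimator ρ τ (Function.update z i 0))
  rwa [ridgeGradient_update_sampleEstimator hρ hτ, ridgeGradient_sampleEstimator hρ hτ, sub_zero,
    norm_smul, Real.norm_eq_abs] at h

/-- Fitting an observation pulls its own residual towards zero. Strong monotonicity gives `ψ(r) (r'
- r) ≥ 0`, and `ψ(r)` has the sign of `r`; if `ψ(r) = 0` the two estimators coincide. This replaces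
a residual that depends on `Xᵢ` nonlinearly by one that is affine in `Xᵢ` given the rest. -/
theorem abs_sampleResidual_le (hρ : LossAssumptions ρ) (hτ : 0 < τ)
    (z : Fin n → EuclideanSpace ℝ (Fin p) × ℝ) (i : Fin n) :
    |sampleResidual z (sampleEstimator ρ τ z) i| ≤
      |sampleResidual z (sampleEstimator ρ τ (Function.update z i 0)) i| := by
  have h := mul_norm_sub_sq_le_inner_ridgeGradient (τ := τ) hρ (Function.update z i 0)
    (sampleEstimator ρ τ z) (sampleEstimator ρ τ (Function.update z i 0))
  rw [ridgeGradient_update_sampleEstimator hρ hτ, ridgeGradient_sampleEstimator hρ hτ, sub_zero,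
    real_inner_smul_left, inner_sub_right] at h
  set b := sampleEstimator ρ τ z
  set a := sampleEstimator ρ τ (Function.update z i 0)
  set r := sampleResidual z b i with hr
  set r' := sampleResidual z a i with hr'
  have hn : (0 : ℝ) < n := by exact_mod_cast i.pos
  have hrr : inner ℝ (z i).1 b - inner ℝ (z i).1 a = r' - r := by
    rw [hr, hr', sampleResidual, sampleResidual]; ring
  rw [hrr] at h
  rcases eq_or_ne (deriv ρ r) 0 with h0 | h0
  · rw [h0, zero_div, zero_mul] at h
    have : b - a = 0 := by
      rw [← norm_eq_zero, ← sq_eq_zero_iff]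
      exact le_antisymm (nonpos_of_mul_nonpos_right h hτ) (sq_nonneg _)
    rw [hr, hr', sub_eq_zero.1 this]
  · have h1 : 0 ≤ deriv ρ r * (r' - r) := by
      have h2 : 0 ≤ deriv ρ r / n * (r' - r) := (by positivity : 0 ≤ τ * ‖b - a‖ ^ 2).trans h
      have h3 := mul_nonneg hn.le h2
      rwa [← mul_assoc, mul_div_cancel₀ _ hn.ne'] at h3
    have hm := hρ.mul_deriv_nonneg r
    rcases lt_or_gt_of_ne h0 with h2 | h2
    · have hr0 : r ≤ 0 := by
        by_contra hc; push Not at hc; nlinarith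
      have : r' ≤ r := by
        by_contra hc; push Not at hc; nlinarith
      rw [abs_of_nonpos hr0, abs_of_nonpos (this.trans hr0)]
      linarith
    · have hr0 : 0 ≤ r := by
        by_contra hc; push Not at hc; nlinarith
      have : r ≤ r' := by
        by_contra hc; push Not at hc; nlinarith
      rw [abs_of_nonneg hr0, abs_of_nonneg (hr0.trans this)]
      linarith

theorem ridgeHessian_apply (z : Fin n → EuclideanSpace ℝ (Fin p) × ℝ)
    (b v : EuclideanSpace ℝ (Fin p)) :
    ridgeHessian ρ τ z b v = τ • v + (1 / (n : ℝ)) •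
      ∑ j, (deriv (deriv ρ) (sampleResidual z b j) * inner ℝ (z j).1 v) • (z j).1 := by
  simp [ridgeHessian, smul_smul]

/-- Since `ψ' ≥ 0`, the Hessian dominates `τ` times the identity; this gives invertibility and the
bound `τ⁻¹` on the inverse. -/
theorem mul_norm_le_norm_ridgeHessian (hρ : LossAssumptions ρ)
    (z : Fin n → EuclideanSpace ℝ (Fin p) × ℝ) (b v : EuclideanSpace ℝ (Fin p)) :
    τ * ‖v‖ ≤ ‖ridgeHessian ρ τ z b v‖ := by
  have h1 : τ * ‖v‖ ^ 2 ≤ inner ℝ (ridgeHessian ρ τ z b v) v := by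
    rw [ridgeHessian_apply]
    simp only [inner_add_left, inner_smul_left, sum_inner, RCLike.conj_to_real]
    rw [real_inner_self_eq_norm_sq, le_add_iff_nonneg_right]
    refine mul_nonneg (by positivity) (Finset.sum_nonneg fun j _ => ?_)
    rw [mul_assoc]
    exact mul_nonneg (hρ.deriv_deriv_nonneg _) (mul_self_nonneg _)
  have h := h1.trans (real_inner_le_norm _ _)
  rcases (norm_nonneg v).eq_or_lt with h0 | h0
  · rw [← h0]; simp
  · refine le_of_mul_le_mul_right ?_ h0
    linarith

theorem isUnit_ridgeHessian (hρ : LossAssumptions ρ) (hτ : 0 < τ)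
    (z : Fin n → EuclideanSpace ℝ (Fin p) × ℝ) (b : EuclideanSpace ℝ (Fin p)) :
    IsUnit (ridgeHessian ρ τ z b) := by
  rw [ContinuousLinearMap.isUnit_iff_bijective]
  have hinj : Function.Injective (ridgeHessian ρ τ z b).toLinearMap := by
    rw [injective_iff_map_eq_zero]
    intro v hv
    have := mul_norm_le_norm_ridgeHessian (τ := τ) hρ z b v
    rw [show ridgeHessian ρ τ z b v = 0 from hv, norm_zero] at this
    exact norm_eq_zero.1 (le_antisymm (nonpos_of_mul_nonpos_right this hτ) (norm_nonneg _))
  exact ⟨hinj, LinearMap.injective_iff_surjective.1 hinj⟩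

/-- The inverse Hessian of the ridge objective at the estimator. -/
noncomputable def inverseHessian (ρ : ℝ → ℝ) (τ : ℝ)
    (z : Fin n → EuclideanSpace ℝ (Fin p) × ℝ) :
    EuclideanSpace ℝ (Fin p) →L[ℝ] EuclideanSpace ℝ (Fin p) :=
  Ring.inverse (ridgeHessian ρ τ z (sampleEstimator ρ τ z))

theorem ridgeHessian_inverseHessian (hρ : LossAssumptions ρ) (hτ : 0 < τ)
    (z : Fin n → EuclideanSpace ℝ (Fin p) × ℝ) (v : EuclideanSpace ℝ (Fin p)) :
    ridgeHessian ρ τ z (sampleEstimator ρ τ z) (inverseHessian ρ τ z v) = v := by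
  have := Ring.mul_inverse_cancel _ (isUnit_ridgeHessian hρ hτ z (sampleEstimator ρ τ z))
  exact congrArg (fun T => T v) this

theorem mul_norm_inverseHessian_le (hρ : LossAssumptions ρ) (hτ : 0 < τ)
    (z : Fin n → EuclideanSpace ℝ (Fin p) × ℝ) (v : EuclideanSpace ℝ (Fin p)) :
    τ * ‖inverseHessian ρ τ z v‖ ≤ ‖v‖ := by
  simpa only [ridgeHessian_inverseHessian hρ hτ] using mul_norm_le_norm_ridgeHessian (τ := τ) hρ z
    (sampleEstimator ρ τ z) (inverseHessian ρ τ z v)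

theorem continuous_inverseHessian (hρ : LossAssumptions ρ) (hτ : 0 < τ) :
    Continuous (inverseHessian (n := n) (p := p) ρ τ) := by
  have hH : Continuous fun z : Fin n → EuclideanSpace ℝ (Fin p) × ℝ =>
      ridgeHessian ρ τ z (sampleEstimator ρ τ z) := by
    unfold ridgeHessian sampleResidual
    have h1 := hρ.continuous_deriv_deriv
    have h2 := continuous_sampleEstimator (n := n) (p := p) hρ hτ
    have h3 : ∀ j, Continuous fun z : Fin n → EuclideanSpace ℝ (Fin p) × ℝ =>
        (innerSL ℝ (z j).1).smulRight (z j).1 := fun j =>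
      continuous_smulRight.comp (((innerSL ℝ).continuous.comp
        (continuous_fst.comp (continuous_apply j))).prodMk (by fun_prop))
    fun_prop
  rw [continuous_iff_continuousAt]
  intro z
  obtain ⟨u, hu⟩ := isUnit_ridgeHessian hρ hτ z (sampleEstimator ρ τ z)
  have h3 := NormedRing.inverse_continuousAt u
  rw [hu] at h3
  exact ContinuousAt.comp (f := fun z => ridgeHessian ρ τ z (sampleEstimator ρ τ z)) h3
    hH.continuousAt

attribute [irreducible] inverseHessian

/-- The second order remainder in the expansion of `deriv ρ` at the residual of observation `j`. -/
noncomputable def taylorRemainder (ρ : ℝ → ℝ) (τ : ℝ)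
    (z : Fin n → EuclideanSpace ℝ (Fin p) × ℝ) (w : EuclideanSpace ℝ (Fin p)) (j : Fin n) : ℝ :=
  deriv ρ (sampleResidual z (sampleEstimator ρ τ z) j) -
    deriv ρ (sampleResidual z (sampleEstimator ρ τ z) j - inner ℝ (z j).1 w) -
    deriv (deriv ρ) (sampleResidual z (sampleEstimator ρ τ z) j) * inner ℝ (z j).1 w

theorem ridgeGradient_add (hρ : LossAssumptions ρ) (hτ : 0 < τ)
    (z : Fin n → EuclideanSpace ℝ (Fin p) × ℝ) (w : EuclideanSpace ℝ (Fin p)) :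
    ridgeGradient ρ τ z (sampleEstimator ρ τ z + w) =
      ridgeHessian ρ τ z (sampleEstimator ρ τ z) w +
        (1 / (n : ℝ)) • ∑ j, taylorRemainder ρ τ z w j • (z j).1 := by
  have h := ridgeGradient_sampleEstimator hρ hτ z
  rw [← sub_zero (ridgeGradient ρ τ z (_ + w)), ← h, ridgeHessian_apply]
  simp only [ridgeGradient, taylorRemainder, sub_smul, Finset.sum_sub_distrib, smul_sub, smul_add,
    sampleResidual, inner_add_right, sub_add_eq_sub_sub]
  abel

/-- Second order leave-one-out expansion of the estimator. -/
theorem norm_sampleEstimator_sub_expansion_sq_le (hρ : LossAssumptions ρ) (hτ : 0 < τ)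
    (z : Fin n → EuclideanSpace ℝ (Fin p) × ℝ) (i : Fin n) (w : EuclideanSpace ℝ (Fin p))
    (hw : w = (deriv ρ (sampleResidual z (sampleEstimator ρ τ z) i) / n) •
      inverseHessian ρ τ (Function.update z i 0) (z i).1) :
    τ ^ 2 * ‖sampleEstimator ρ τ (Function.update z i 0) + w - sampleEstimator ρ τ z‖ ^ 2 ≤
      ‖designMap fun j => (z j).1‖ ^ 2 / n *
        ((1 / (n : ℝ)) * ∑ j, taylorRemainder ρ τ (Function.update z i 0) w j ^ 2) := by
  set y := Function.update z i 0 with hy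
  have h := mul_norm_sub_le_norm_ridgeGradient (τ := τ) hρ y (sampleEstimator ρ τ y + w)
    (sampleEstimator ρ τ z)
  -- `w` solves the linearized equation exactly, so the first-order terms of the two gradients
  -- cancel and only Taylor remainders are left.
  have hH : ridgeHessian ρ τ y (sampleEstimator ρ τ y) w =
      (deriv ρ (sampleResidual z (sampleEstimator ρ τ z) i) / n) • (z i).1 := by
    rw [hw, map_smul, ridgeHessian_inverseHessian hρ hτ]
  rw [ridgeGradient_add hρ hτ, hH, ridgeGradient_update_sampleEstimator hρ hτ, add_sub_cancel_left,
    norm_smul] at h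
  -- The remainder of the deleted observation is zero, so its design vector may be restored and the
  -- design matrix of the full sample used for every `i`.
  have hR : ∑ j, taylorRemainder ρ τ y w j • (y j).1 =
      ∑ j, taylorRemainder ρ τ y w j • (z j).1 := by
    refine Finset.sum_congr rfl fun j _ => ?_
    rcases eq_or_ne j i with rfl | hj
    · have : taylorRemainder ρ τ y w j = 0 := by simp [taylorRemainder, hy]
      rw [this, zero_smul, zero_smul]
    · rw [hy, Function.update_of_ne hj]
  rw [hR] at h
  have h2 := pow_le_pow_left₀ (by positivity) h 2
  rw [mul_pow, mul_pow] at h2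
  refine h2.trans ?_
  have h3 := norm_sum_smul_sq_le (fun j => (z j).1) (taylorRemainder ρ τ y w)
  calc ‖1 / (n : ℝ)‖ ^ 2 * ‖∑ j, taylorRemainder ρ τ y w j • (z j).1‖ ^ 2
      ≤ ‖1 / (n : ℝ)‖ ^ 2 * (‖designMap fun j => (z j).1‖ ^ 2 *
        ∑ j, taylorRemainder ρ τ y w j ^ 2) := by gcongr
    _ = _ := by rw [Real.norm_eq_abs, sq_abs]; ring

end Deterministic

/-! ### The Efron–Stein inequality for independent variables with different laws. -/

section EfronStein

variable {α β : Type*} [MeasurableSpace α] [MeasurableSpace β] {μ : Measure α} {ν : Measure β}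
  [IsProbabilityMeasure μ] [IsProbabilityMeasure ν]

theorem sq_integral_le_integral_sq {f : α → ℝ} (hf : MemLp f 2 μ) :
    (∫ a, f a ∂μ) ^ 2 ≤ ∫ a, f a ^ 2 ∂μ := by
  have h := variance_nonneg f μ
  rw [variance_eq_sub hf] at h
  simpa using h

theorem ae_memLp_two_prodMk {f : β × α → ℝ} (hf : MemLp f 2 (ν.prod μ)) :
    ∀ᵐ b ∂ν, MemLp (fun a => f (b, a)) 2 μ := by
  filter_upwards [hf.integrable_sq.prod_right_ae, hf.1.prodMk_left] with b h1 h2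
  exact (memLp_two_iff_integrable_sq h2).2 h1

theorem memLp_two_integral_prod {f : β × α → ℝ} (hf : MemLp f 2 (ν.prod μ)) :
    MemLp (fun b => ∫ a, f (b, a) ∂μ) 2 ν := by
  have hm := hf.1.integral_prod_right'
  rw [memLp_two_iff_integrable_sq hm]
  refine hf.integrable_sq.integral_prod_left.mono' (hm.pow 2) ?_
  filter_upwards [ae_memLp_two_prodMk hf] with b hb
  rw [Real.norm_of_nonneg (sq_nonneg _)]
  exact sq_integral_le_integral_sq hb

/-- Pythagoras: `f` minus its average over `α` is orthogonal to every square integrable function of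
`b` alone. -/
theorem integral_sub_sq_eq_add {f : β × α → ℝ} {g : β → ℝ} (hf : MemLp f 2 (ν.prod μ))
    (hg : MemLp g 2 ν) :
    ∫ q, (f q - g q.1) ^ 2 ∂(ν.prod μ) =
      ∫ q, (f q - ∫ a, f (q.1, a) ∂μ) ^ 2 ∂(ν.prod μ) +
        ∫ b, ((∫ a, f (b, a) ∂μ) - g b) ^ 2 ∂ν := by
  set A : β → ℝ := fun b => ∫ a, f (b, a) ∂μ with hA
  have hAm : MemLp A 2 ν := memLp_two_integral_prod hf
  have hfst : ∀ {h : β → ℝ}, MemLp h 2 ν → MemLp (fun q : β × α => h q.1) 2 (ν.prod μ) :=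
    fun hh => hh.comp_measurePreserving measurePreserving_fst
  have hint : ∀ h : β → ℝ, ∫ q, h q.1 ∂(ν.prod μ) = ∫ b, h b ∂ν := fun h => by
    simpa using integral_prod_mul (μ := ν) (ν := μ) h fun _ => (1 : ℝ)
  set D : β → ℝ := fun b => A b - g b with hD
  have hDm : MemLp D 2 ν := hAm.sub hg
  have hfA : MemLp (fun q => f q - A q.1) 2 (ν.prod μ) := hf.sub (hfst hAm)
  have hcross : ∫ q, (f q - A q.1) * D q.1 ∂(ν.prod μ) = 0 := by
    have h1 : Integrable (fun q => (f q - A q.1) * D q.1) (ν.prod μ) :=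
      hfA.integrable_mul (hfst hDm)
    rw [integral_prod _ h1]
    refine integral_eq_zero_of_ae ?_
    filter_upwards [ae_memLp_two_prodMk hf] with b hb
    simp only [Pi.zero_apply]
    rw [integral_mul_const, integral_sub (hb.integrable (by norm_num)) (integrable_const _)]
    simp [hA]
  have h2 : ∀ q : β × α, (f q - g q.1) ^ 2 =
      (f q - A q.1) ^ 2 + (2 * ((f q - A q.1) * D q.1) + D q.1 ^ 2) := fun q => by
    simp only [hD]; ring
  have i1 : Integrable (fun q : β × α => D q.1 ^ 2) (ν.prod μ) := (hfst hDm).integrable_sq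
  have i2 : Integrable (fun q => (f q - A q.1) * D q.1) (ν.prod μ) :=
    hfA.integrable_mul (hfst hDm)
  have i3 : Integrable (fun q => 2 * ((f q - A q.1) * D q.1) + D q.1 ^ 2) (ν.prod μ) :=
    (i2.const_mul 2).add i1
  simp_rw [h2]
  rw [integral_add hfA.integrable_sq i3, integral_add (i2.const_mul 2) i1,
    integral_const_mul, hcross, mul_zero, zero_add, hint fun b => D b ^ 2]

/-- Averaging over one variable is an `L²` contraction; this is Pythagoras for `f - g` against `0`.
-/
theorem integral_sq_integral_sub_le {f g : β × α → ℝ} (hf : MemLp f 2 (ν.prod μ))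
    (hg : MemLp g 2 (ν.prod μ)) :
    ∫ b, ((∫ a, f (b, a) ∂μ) - ∫ a, g (b, a) ∂μ) ^ 2 ∂ν ≤ ∫ q, (f q - g q) ^ 2 ∂(ν.prod μ) := by
  have h := integral_sub_sq_eq_add (hf.sub hg) (MemLp.zero (p := 2) (μ := ν) (ε := ℝ))
  simp only [Pi.zero_apply, sub_zero, Pi.sub_apply] at h
  rw [h]
  have h1 : ∫ b, ((∫ a, f (b, a) ∂μ) - ∫ a, g (b, a) ∂μ) ^ 2 ∂ν =
      ∫ b, (∫ a, f (b, a) - g (b, a) ∂μ) ^ 2 ∂ν := by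
    refine integral_congr_ae ?_
    filter_upwards [ae_memLp_two_prodMk hf, ae_memLp_two_prodMk hg] with b h1 h2
    rw [integral_sub (h1.integrable (by norm_num)) (h2.integrable (by norm_num))]
  rw [h1, le_add_iff_nonneg_left]
  exact integral_nonneg fun _ => sq_nonneg _

/-- The **Efron–Stein inequality**: the variance of a function of independent variables is at most
the sum of the squared `L²` distances to functions not depending on the `k`-th variable. -/
theorem efronStein_pi : ∀ {n : ℕ} (μ : Fin n → Measure α) [∀ i, IsProbabilityMeasure (μ i)]
    (f : (Fin n → α) → ℝ) (g : Fin n → (Fin n → α) → ℝ), MemLp f 2 (Measure.pi μ) →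
    (∀ k, MemLp (g k) 2 (Measure.pi μ)) → (∀ k z y, g k (Function.update z k y) = g k z) →
    ∫ z, (f z - ∫ z, f z ∂(Measure.pi μ)) ^ 2 ∂(Measure.pi μ) ≤
      ∑ k, ∫ z, (f z - g k z) ^ 2 ∂(Measure.pi μ)
  | 0, μ, _, f, g, _, _, _ => by
    have h : ∀ z : Fin 0 → α, f z = f default := fun z => by rw [Subsingleton.elim z default]
    simp_rw [h]
    simp
  | n + 1, μ, _, f, g, hf, hg, hgk => by
    have := (Measure.pi.instIsProbabilityMeasure fun j : Fin n => μ j.succ)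
    set ν := Measure.pi fun j : Fin n => μ j.succ with hν
    let e : (Fin (n + 1) → α) ≃ᵐ (Fin n → α) × α :=
      (MeasurableEquiv.piFinSuccAbove (fun _ => α) 0).trans MeasurableEquiv.prodComm
    have he : MeasurePreserving e (Measure.pi μ) (ν.prod (μ 0)) :=
      Measure.measurePreserving_swap.comp (measurePreserving_piFinSuccAbove μ 0)
    have hes := he.symm
    have hesymm : ∀ z a, e.symm (z, a) = Fin.cons a z := fun z a =>
      Fin.insertNth_zero' a z
    have hint : ∀ h : (Fin (n + 1) → α) → ℝ,
        ∫ z, h z ∂(Measure.pi μ) = ∫ q, h (e.symm q) ∂(ν.prod (μ 0)) := fun h =>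
      (hes.integral_comp' h).symm
    set F := fun q => f (e.symm q) with hF
    set G := fun k q => g k (e.symm q) with hG
    have hFm : MemLp F 2 (ν.prod (μ 0)) := hf.comp_measurePreserving hes
    have hGm : ∀ k, MemLp (G k) 2 (ν.prod (μ 0)) := fun k => (hg k).comp_measurePreserving hes
    set AF : (Fin n → α) → ℝ := fun z => ∫ a, F (z, a) ∂(μ 0) with hAF
    have hAFm : MemLp AF 2 ν := memLp_two_integral_prod hFm
    have hmean : ∫ q, F q ∂(ν.prod (μ 0)) = ∫ z, AF z ∂ν :=
      integral_prod _ (hFm.integrable (by norm_num))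
    -- The variance splits into the part explained by coordinate `0` and the variance of the average
    -- `AF`, to which induction applies.
    have hpy := integral_sub_sq_eq_add hFm (memLp_const (∫ z, AF z ∂ν))
    have ih := efronStein_pi (fun j : Fin n => μ j.succ) AF
      (fun k z => ∫ a, G k.succ (z, a) ∂(μ 0)) hAFm
      (fun k => memLp_two_integral_prod (hGm k.succ)) (fun k z y => by
        refine integral_congr_ae (Eventually.of_forall fun a => ?_)
        simp only [hG, hesymm]
        rw [Fin.cons_update, hgk])
    -- `g 0` ignores coordinate `0`, so freezing it at any `a₀` turns `g 0` into a function of the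
    -- others; it is no closer to `f` than the average `AF`.
    obtain ⟨a₀⟩ : Nonempty α := (μ 0).nonempty_of_neZero
    have hG0 : ∀ q, G 0 q = G 0 (q.1, a₀) := fun ⟨z, a⟩ => by
      simp only [hG, hesymm]
      rw [← hgk 0 (Fin.cons a z) a₀, Fin.update_cons_zero]
    have hG0m : MemLp (fun z => G 0 (z, a₀)) 2 ν := by
      have h1 := memLp_two_integral_prod (hGm 0)
      refine h1.ae_eq (Eventually.of_forall fun z => ?_)
      simp only
      have : ∀ a, G 0 (z, a) = G 0 (z, a₀) := fun a => hG0 (z, a)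
      simp_rw [this]
      simp
    have h0 := integral_sub_sq_eq_add hFm hG0m
    rw [hint f]
    rw [hint fun z => (f z - ∫ q, f (e.symm q) ∂(ν.prod (μ 0))) ^ 2, Fin.sum_univ_succ]
    change ∫ q, (F q - ∫ q, F q ∂(ν.prod (μ 0))) ^ 2 ∂(ν.prod (μ 0)) ≤ _
    rw [hmean, hpy]
    refine add_le_add ?_ (ih.trans (Finset.sum_le_sum fun k _ => ?_))
    · rw [hint fun z => (f z - g 0 z) ^ 2]
      change _ ≤ ∫ q, (F q - G 0 q) ^ 2 ∂(ν.prod (μ 0))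
      simp_rw [fun q => hG0 q]
      rw [h0, le_add_iff_nonneg_right]
      exact integral_nonneg fun _ => sq_nonneg _
    · rw [hint fun z => (f z - g k.succ z) ^ 2]
      exact integral_sq_integral_sub_le hFm (hGm k.succ)

theorem variance_le_sum_integral_sq_sub_update {Ω : Type*} [MeasurableSpace Ω] {P : Measure Ω}
    [IsProbabilityMeasure P] {n : ℕ} {Z : Fin n → Ω → α} (hZ : ∀ i, Measurable (Z i))
    (hind : iIndepFun Z P) {f : (Fin n → α) → ℝ} (hf : Measurable f) (a : α)
    (hf2 : MemLp (fun ω => f fun i => Z i ω) 2 P)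
    (hg2 : ∀ k, MemLp (fun ω => f (Function.update (fun i => Z i ω) k a)) 2 P) :
    variance (fun ω => f fun i => Z i ω) P ≤
      ∑ k, ∫ ω, (f (fun i => Z i ω) - f (Function.update (fun i => Z i ω) k a)) ^ 2 ∂P := by
  have hmap := hind.map_fun_eq_pi_map fun i => (hZ i).aemeasurable
  have := fun i => Measure.isProbabilityMeasure_map (μ := P) (hZ i).aemeasurable
  have hmp : MeasurePreserving (fun ω i => Z i ω) P (Measure.pi fun i => P.map (Z i)) :=
    ⟨measurable_pi_lambda _ hZ, hmap⟩
  have hu : ∀ k, Measurable fun z : Fin n → α => f (Function.update z k a) := fun k =>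
    hf.comp measurable_update_left
  have hmem : ∀ h : (Fin n → α) → ℝ, Measurable h → MemLp (fun ω => h fun i => Z i ω) 2 P →
      MemLp h 2 (Measure.pi fun i => P.map (Z i)) := fun h hh hm => by
    rw [← hmap]
    exact (memLp_map_measure_iff hh.aestronglyMeasurable hmp.measurable.aemeasurable).2 hm
  have h1 := efronStein_pi (fun i => P.map (Z i)) f (fun k z => f (Function.update z k a))
    (hmem f hf hf2) (fun k => hmem _ (hu k) (hg2 k))
    (fun k z y => by rw [Function.update_idem])
  have hint : ∀ h : (Fin n → α) → ℝ, Measurable h →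
      ∫ z, h z ∂(Measure.pi fun i => P.map (Z i)) = ∫ ω, h (fun i => Z i ω) ∂P := fun h hh => by
    rw [← hmp.map_eq, integral_map hmp.measurable.aemeasurable hh.aestronglyMeasurable]
  rw [hint f hf, hint _ ((hf.sub_const _).pow_const 2)] at h1
  rw [variance_eq_integral hf2.1.aemeasurable]
  refine h1.trans (le_of_eq (Finset.sum_congr rfl fun k _ => ?_))
  exact hint _ ((hf.sub (hu k)).pow_const 2)

end EfronStein

/-! ### Calculus of triangular arrays with polylogarithmic moments. -/

section Polylog

variable {ι κ : ℕ → Type}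

/-- A triangular array of extended nonnegative numbers is uniformly bounded by a power of `log n`
for large `n`. -/
def IsPolylog (u : ∀ n, ι n → ℝ≥0∞) : Prop :=
  ∃ b : ℕ, ∃ K : ℝ, ∀ᶠ n : ℕ in atTop, ∀ i, u n i ≤ ENNReal.ofReal (K * Real.log n ^ b)

theorem eventually_one_le_log : ∀ᶠ n : ℕ in atTop, 1 ≤ Real.log n :=
  (Real.tendsto_log_atTop.comp tendsto_natCast_atTop_atTop).eventually_ge_atTop 1

namespace IsPolylog

variable {u v : ∀ n, ι n → ℝ≥0∞}

theorem mono (hv : IsPolylog v) (h : ∀ᶠ n in atTop, ∀ i, u n i ≤ v n i) : IsPolylog u := by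
  obtain ⟨b, K, hb⟩ := hv
  exact ⟨b, K, by filter_upwards [hb, h] with n h1 h2 i using (h2 i).trans (h1 i)⟩

theorem const (c : ℝ) : IsPolylog fun n (_ : ι n) => ENNReal.ofReal c :=
  ⟨0, c, by simp⟩

theorem add (hu : IsPolylog u) (hv : IsPolylog v) : IsPolylog fun n i => u n i + v n i := by
  obtain ⟨b, K, hb⟩ := hu
  obtain ⟨b', K', hb'⟩ := hv
  refine ⟨b + b', |K| + |K'|, ?_⟩
  filter_upwards [hb, hb', eventually_one_le_log] with n h1 h2 h3 i
  have hl : 0 ≤ Real.log n := by linarith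
  refine (add_le_add (h1 i) (h2 i)).trans ?_
  rw [add_mul, ENNReal.ofReal_add (by positivity) (by positivity)]
  refine add_le_add (ENNReal.ofReal_le_ofReal ?_) (ENNReal.ofReal_le_ofReal ?_)
  · exact mul_le_mul (le_abs_self K) (pow_le_pow_right₀ h3 (by omega)) (by positivity)
      (abs_nonneg K)
  · exact mul_le_mul (le_abs_self K') (pow_le_pow_right₀ h3 (by omega)) (by positivity)
      (abs_nonneg K')

theorem mul (hu : IsPolylog u) (hv : IsPolylog v) : IsPolylog fun n i => u n i * v n i := by
  obtain ⟨b, K, hb⟩ := hu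
  obtain ⟨b', K', hb'⟩ := hv
  refine ⟨b + b', |K| * |K'|, ?_⟩
  filter_upwards [hb, hb', eventually_one_le_log] with n h1 h2 h3 i
  have hl : 0 ≤ Real.log n := by linarith
  refine (mul_le_mul' (h1 i) (h2 i)).trans ?_
  rw [show |K| * |K'| * Real.log n ^ (b + b') =
    |K| * Real.log n ^ b * (|K'| * Real.log n ^ b') by ring, ENNReal.ofReal_mul (mul_nonneg (abs_nonneg K) (pow_nonneg hl b))]
  have hpow : ∀ m : ℕ, 0 ≤ Real.log n ^ m := fun m => pow_nonneg hl m
  exact mul_le_mul'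
    (ENNReal.ofReal_le_ofReal (mul_le_mul_of_nonneg_right (le_abs_self K) (hpow b)))
    (ENNReal.ofReal_le_ofReal (mul_le_mul_of_nonneg_right (le_abs_self K') (hpow b')))

theorem const_mul (hu : IsPolylog u) (c : ℝ) : IsPolylog fun n i => ENNReal.ofReal c * u n i :=
  (const c).mul hu

theorem pow (hu : IsPolylog u) (k : ℕ) : IsPolylog fun n i => u n i ^ k := by
  induction k with
  | zero => simpa using const (ι := ι) 1
  | succ k ih => simpa only [pow_succ] using ih.mul hu

end IsPolylog

variable {Ω : ℕ → Type*} [∀ n, MeasurableSpace (Ω n)] {P : ∀ n, Measure (Ω n)}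

/-- A triangular array of real random variables all of whose absolute moments are uniformly bounded
by a power of `log n`, for large `n`. -/
def HasPolylogMoments (P : ∀ n, Measure (Ω n)) (Y : ∀ n, ι n → Ω n → ℝ) : Prop :=
  (∀ n i, Measurable (Y n i)) ∧
    ∀ k : ℕ, IsPolylog fun n i => ∫⁻ ω, ENNReal.ofReal (|Y n i ω| ^ k) ∂(P n)

namespace HasPolylogMoments

variable {Y Z : ∀ n, ι n → Ω n → ℝ}

theorem measurable (h : HasPolylogMoments P Y) (n : ℕ) (i : ι n) : Measurable (Y n i) := h.1 n i

theorem mono (hZ : HasPolylogMoments P Z) (hY : ∀ n i, Measurable (Y n i))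
    (h : ∀ᶠ n in atTop, ∀ i ω, |Y n i ω| ≤ |Z n i ω|) : HasPolylogMoments P Y := by
  refine ⟨hY, fun k => (hZ.2 k).mono ?_⟩
  filter_upwards [h] with n hn i
  exact lintegral_mono fun ω => ENNReal.ofReal_le_ofReal
    (pow_le_pow_left₀ (abs_nonneg _) (hn i ω) k)

theorem add (hY : HasPolylogMoments P Y) (hZ : HasPolylogMoments P Z) :
    HasPolylogMoments P fun n i ω => Y n i ω + Z n i ω := by
  refine ⟨fun n i => (hY.1 n i).add (hZ.1 n i), fun k => ?_⟩
  refine (((hY.2 k).add (hZ.2 k)).const_mul (2 ^ (k - 1))).mono (Eventually.of_forall fun n i => ?_)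
  have hm : Measurable fun ω => ENNReal.ofReal (|Y n i ω| ^ k) :=
    ((hY.1 n i).abs.pow_const k).ennreal_ofReal
  rw [← lintegral_add_left hm, ← lintegral_const_mul' _ _ ENNReal.ofReal_ne_top]
  refine lintegral_mono fun ω => ?_
  rw [← ENNReal.ofReal_add (by positivity) (by positivity), ← ENNReal.ofReal_mul (by positivity)]
  refine ENNReal.ofReal_le_ofReal ?_
  exact (pow_le_pow_left₀ (abs_nonneg _) (abs_add_le _ _) k).trans
    (add_pow_le (abs_nonneg _) (abs_nonneg _) k)

/-- No independence is needed, since `2|yz|^k ≤ |y|^(2k) + |z|^(2k)` and moments of every order are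
controlled. -/
theorem mul (hY : HasPolylogMoments P Y) (hZ : HasPolylogMoments P Z) :
    HasPolylogMoments P fun n i ω => Y n i ω * Z n i ω := by
  refine ⟨fun n i => (hY.1 n i).mul (hZ.1 n i), fun k => ?_⟩
  refine ((hY.2 (k * 2)).add (hZ.2 (k * 2))).mono (Eventually.of_forall fun n i => ?_)
  have hm : Measurable fun ω => ENNReal.ofReal (|Y n i ω| ^ (k * 2)) :=
    ((hY.1 n i).abs.pow_const (k * 2)).ennreal_ofReal
  rw [← lintegral_add_left hm]
  refine lintegral_mono fun ω => ?_
  rw [← ENNReal.ofReal_add (by positivity) (by positivity)]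
  refine ENNReal.ofReal_le_ofReal ?_
  rw [abs_mul, mul_pow, pow_mul, pow_mul]
  have := two_mul_le_add_sq (|Y n i ω| ^ k) (|Z n i ω| ^ k)
  have h0 : 0 ≤ |Y n i ω| ^ k * |Z n i ω| ^ k := by positivity
  linarith

theorem comp {κ : ℕ → Type} (hY : HasPolylogMoments P Y) (φ : ∀ n, κ n → ι n) :
    HasPolylogMoments P fun n j ω => Y n (φ n j) ω := by
  refine ⟨fun n j => hY.1 n _, fun k => ?_⟩
  obtain ⟨b, K, hb⟩ := hY.2 k
  exact ⟨b, K, by filter_upwards [hb] with n hn j using hn (φ n j)⟩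

theorem of_deterministic [∀ n, IsProbabilityMeasure (P n)] {a : ∀ n, ι n → ℝ}
    (ha : IsPolylog fun n i => ENNReal.ofReal |a n i|) :
    HasPolylogMoments P fun n i _ => a n i := by
  refine ⟨fun n i => measurable_const, fun k => (ha.pow k).mono (Eventually.of_forall fun n i => ?_)⟩
  simp [ENNReal.ofReal_pow]

theorem const [∀ n, IsProbabilityMeasure (P n)] (c : ℝ) :
    HasPolylogMoments P fun n (_ : ι n) _ => c :=
  of_deterministic (IsPolylog.const |c|)

theorem const_mul [∀ n, IsProbabilityMeasure (P n)] (hY : HasPolylogMoments P Y) (c : ℝ) :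
    HasPolylogMoments P fun n i ω => c * Y n i ω :=
  (const c).mul hY

theorem pow [∀ n, IsProbabilityMeasure (P n)] (hY : HasPolylogMoments P Y) (k : ℕ) :
    HasPolylogMoments P fun n i ω => Y n i ω ^ k := by
  induction k with
  | zero => simpa using const (P := P) (ι := ι) 1
  | succ k ih => simpa only [pow_succ] using ih.mul hY

theorem abs (hY : HasPolylogMoments P Y) : HasPolylogMoments P fun n i ω => |Y n i ω| :=
  hY.mono (fun n i => (hY.1 n i).abs) (by simp)

theorem of_sq_moments [∀ n, IsProbabilityMeasure (P n)] (hm : ∀ n i, Measurable (Y n i))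
    (h : ∀ k : ℕ, IsPolylog fun n i => ∫⁻ ω, ENNReal.ofReal ((Y n i ω ^ 2) ^ k) ∂(P n)) :
    HasPolylogMoments P Y := by
  refine ⟨hm, fun k => ((IsPolylog.const 1).add (h k)).mono (Eventually.of_forall fun n i => ?_)⟩
  calc ∫⁻ ω, ENNReal.ofReal (|Y n i ω| ^ k) ∂(P n)
      ≤ ∫⁻ ω, (1 + ENNReal.ofReal ((Y n i ω ^ 2) ^ k)) ∂(P n) := by
        refine lintegral_mono fun ω => ?_
        rw [← ENNReal.ofReal_one, ← ENNReal.ofReal_add zero_le_one (by positivity)]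
        refine ENNReal.ofReal_le_ofReal ?_
        rw [← sq_abs, ← pow_mul, mul_comm, pow_mul]
        nlinarith [sq_nonneg (|Y n i ω| ^ k - 1), sq_nonneg (|Y n i ω| ^ k)]
    _ = _ := by rw [lintegral_add_left measurable_const]; simp

/-- Convexity of the `k`-th power gives a bound that does not depend on the number of averaged
terms. -/
theorem average {κ : ℕ → Type} [∀ n, IsProbabilityMeasure (P n)] [∀ n, Fintype (κ n)] {Y : ∀ n, ι n × κ n → Ω n → ℝ}
    (hY : HasPolylogMoments P Y) :
    HasPolylogMoments P fun n i ω =>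
      (1 / (Fintype.card (κ n) : ℝ)) * ∑ j, Y n (i, j) ω := by
  refine ⟨fun n i => (Finset.measurable_sum _ fun j _ => hY.1 n (i, j)).const_mul _, fun k => ?_⟩
  obtain ⟨b, K, hb⟩ := hY.2 k
  rcases k.eq_zero_or_pos with rfl | hk
  · exact (IsPolylog.const 1).mono (Eventually.of_forall fun n i => by simp)
  refine ⟨b, K, ?_⟩
  filter_upwards [hb] with n hn i
  rcases isEmpty_or_nonempty (κ n) with he | he
  · simp [hk.ne']
  have hc : (0 : ℝ) < Fintype.card (κ n) := by exact_mod_cast Fintype.card_pos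
  calc ∫⁻ ω, ENNReal.ofReal (|(1 / (Fintype.card (κ n) : ℝ)) * ∑ j, Y n (i, j) ω| ^ k) ∂(P n)
      ≤ ∫⁻ ω, ∑ j, ENNReal.ofReal (1 / (Fintype.card (κ n) : ℝ)) *
          ENNReal.ofReal (|Y n (i, j) ω| ^ k) ∂(P n) := by
        refine lintegral_mono fun ω => ?_
        simp_rw [← ENNReal.ofReal_mul (show 0 ≤ 1 / (Fintype.card (κ n) : ℝ) by positivity)]
        rw [← ENNReal.ofReal_sum_of_nonneg fun j _ => by positivity]
        refine ENNReal.ofReal_le_ofReal ?_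
        refine le_trans (pow_le_pow_left₀ (abs_nonneg _) ?_ k)
          (Real.pow_arith_mean_le_arith_mean_pow Finset.univ
            (fun _ => 1 / (Fintype.card (κ n) : ℝ)) (fun j => |Y n (i, j) ω|)
            (fun _ _ => by positivity) (by simp [hc.ne']) (fun _ _ => abs_nonneg _) k)
        rw [Finset.mul_sum]
        refine (Finset.abs_sum_le_sum_abs _ _).trans (le_of_eq ?_)
        refine Finset.sum_congr rfl fun j _ => ?_
        rw [abs_mul, abs_of_nonneg (show 0 ≤ 1 / (Fintype.card (κ n) : ℝ) by positivity)]
    _ = ∑ j, ENNReal.ofReal (1 / (Fintype.card (κ n) : ℝ)) *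
          ∫⁻ ω, ENNReal.ofReal (|Y n (i, j) ω| ^ k) ∂(P n) := by
        rw [lintegral_finsetSum]
        · refine Finset.sum_congr rfl fun j _ => ?_
          rw [lintegral_const_mul' _ _ ENNReal.ofReal_ne_top]
        · exact fun j _ => ((hY.1 n (i, j)).abs.pow_const k).ennreal_ofReal.const_mul _
    _ ≤ ∑ j : κ n, ENNReal.ofReal (1 / (Fintype.card (κ n) : ℝ)) *
          ENNReal.ofReal (K * Real.log n ^ b) :=
        Finset.sum_le_sum fun j _ => mul_le_mul_right (hn (i, j)) _
    _ = ENNReal.ofReal (K * Real.log n ^ b) := by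
        rw [Finset.sum_const, Finset.card_univ, nsmul_eq_mul, ← mul_assoc,
          ← ENNReal.ofReal_natCast, ← ENNReal.ofReal_mul hc.le, mul_one_div_cancel hc.ne',
          ENNReal.ofReal_one, one_mul]

end HasPolylogMoments

end Polylog

/-! ### From subgaussian tails to exponential square moments. -/

section Subgaussian

variable {Ω : Type*} [MeasurableSpace Ω] {P : Measure Ω} [IsProbabilityMeasure P]

theorem hasDerivAt_exp_mul_sq (b x : ℝ) :
    HasDerivAt (fun t => Real.exp (b * t ^ 2)) (2 * b * x * Real.exp (b * x ^ 2)) x := by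
  have h := (((hasDerivAt_pow 2 x).const_mul b).exp)
  convert h using 1
  simp
  ring

/-- Layer-cake formula for `exp(c y²/2) - 1`. With half the rate, tail times derivative is at most
`C · c t exp(-c t²/2)`, which integrates to `C`. -/
theorem lintegral_exp_sq_le_of_tail {Y : Ω → ℝ} (hY : Measurable Y) {C c : ℝ} (hc : 0 < c)
    (h : ∀ t : ℝ, 0 < t → P.real {ω | t < |Y ω|} ≤ C * Real.exp (-c * t ^ 2)) :
    ∫⁻ ω, ENNReal.ofReal (Real.exp (c / 2 * Y ω ^ 2)) ∂P ≤ ENNReal.ofReal (1 + C) := by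
  have hC : 0 ≤ C := by
    have h1 := measureReal_nonneg.trans (h 1 one_pos)
    exact nonneg_of_mul_nonneg_left h1 (Real.exp_pos _)
  set g : ℝ → ℝ := fun t => 2 * (c / 2) * t * Real.exp (c / 2 * t ^ 2) with hg
  have hgc : Continuous g := by fun_prop
  have hint : ∀ y, ∫ t in (0 : ℝ)..y, g t = Real.exp (c / 2 * y ^ 2) - 1 := fun y => by
    rw [intervalIntegral.integral_eq_sub_of_hasDerivAt
      (fun x _ => hasDerivAt_exp_mul_sq (c / 2) x) (hgc.intervalIntegrable _ _)]
    simp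
  have hlc := lintegral_comp_eq_lintegral_meas_lt_mul P (f := fun ω => |Y ω|) (g := g)
    (Eventually.of_forall fun ω => abs_nonneg _) hY.abs.aemeasurable
    (fun t _ => hgc.intervalIntegrable _ _)
    ((ae_restrict_iff' measurableSet_Ioi).2 (Eventually.of_forall fun t ht => by
      have : (0 : ℝ) < t := ht
      positivity))
  have hder : ∀ x ∈ Set.Ici (0 : ℝ), HasDerivAt (fun t => -Real.exp (-(c / 2) * t ^ 2))
      (c * x * Real.exp (-(c / 2) * x ^ 2)) x := fun x _ =>
    (hasDerivAt_exp_mul_sq (-(c / 2)) x).fun_neg.congr_deriv (by ring)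
  have hpos : ∀ x ∈ Set.Ioi (0 : ℝ), 0 ≤ c * x * Real.exp (-(c / 2) * x ^ 2) := fun x hx => by
    have : (0 : ℝ) < x := hx
    positivity
  have hlim : Tendsto (fun t : ℝ => -Real.exp (-(c / 2) * t ^ 2)) atTop (𝓝 0) := by
    rw [← neg_zero]
    refine (Real.tendsto_exp_atBot.comp ?_).neg
    exact Tendsto.const_mul_atTop_of_neg (by linarith) (tendsto_pow_atTop two_ne_zero)
  have hI := integral_Ioi_of_hasDerivAt_of_nonneg' hder hpos hlim
  have hIi := integrableOn_Ioi_deriv_of_nonneg' hder hpos hlim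
  have hI' : ∫⁻ t in Set.Ioi (0 : ℝ), ENNReal.ofReal (c * t * Real.exp (-(c / 2) * t ^ 2)) = 1 := by
    rw [← ofReal_integral_eq_lintegral_ofReal hIi
      ((ae_restrict_iff' measurableSet_Ioi).2 (Eventually.of_forall hpos)), hI]
    simp
  have hbound : ∫⁻ ω, ENNReal.ofReal (Real.exp (c / 2 * Y ω ^ 2) - 1) ∂P ≤ ENNReal.ofReal C := by
    simp_rw [hint, sq_abs] at hlc
    rw [hlc]
    calc ∫⁻ t in Set.Ioi (0 : ℝ), P {a | t < |Y a|} * ENNReal.ofReal (g t)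
        ≤ ∫⁻ t in Set.Ioi (0 : ℝ),
            ENNReal.ofReal C * ENNReal.ofReal (c * t * Real.exp (-(c / 2) * t ^ 2)) := by
          refine setLIntegral_mono' measurableSet_Ioi fun t ht => ?_
          have ht : (0 : ℝ) < t := ht
          rw [← ofReal_measureReal, ← ENNReal.ofReal_mul measureReal_nonneg,
            ← ENNReal.ofReal_mul hC]
          refine ENNReal.ofReal_le_ofReal ?_
          calc P.real {a | t < |Y a|} * g t ≤ C * Real.exp (-c * t ^ 2) * g t :=
                mul_le_mul_of_nonneg_right (h t ht) (by positivity)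
            _ = _ := by
                have : Real.exp (-(c / 2) * t ^ 2) =
                    Real.exp (-c * t ^ 2) * Real.exp (c / 2 * t ^ 2) := by
                  rw [← Real.exp_add]; congr 1; ring
                rw [this, hg]
                ring
      _ = ENNReal.ofReal C := by
          rw [lintegral_const_mul' _ _ ENNReal.ofReal_ne_top, hI', mul_one]
  calc ∫⁻ ω, ENNReal.ofReal (Real.exp (c / 2 * Y ω ^ 2)) ∂P
      = ∫⁻ ω, (1 + ENNReal.ofReal (Real.exp (c / 2 * Y ω ^ 2) - 1)) ∂P := by
        refine lintegral_congr fun ω => ?_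
        rw [← ENNReal.ofReal_one, ← ENNReal.ofReal_add zero_le_one]
        · congr 1; ring
        · have := Real.one_le_exp (show 0 ≤ c / 2 * Y ω ^ 2 by positivity)
          linarith
    _ ≤ 1 + ENNReal.ofReal C := by
        rw [lintegral_add_left measurable_const]
        simpa using add_le_add_right hbound 1
    _ = ENNReal.ofReal (1 + C) := by rw [ENNReal.ofReal_add zero_le_one hC, ENNReal.ofReal_one]

theorem lintegral_sq_le_of_tail {Y : Ω → ℝ} (hY : Measurable Y) {C c : ℝ} (hc : 0 < c)
    (h : ∀ t : ℝ, 0 < t → P.real {ω | t < |Y ω|} ≤ C * Real.exp (-c * t ^ 2)) :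
    ∫⁻ ω, ENNReal.ofReal (Y ω ^ 2) ∂P ≤ ENNReal.ofReal (2 / c * (1 + C)) := by
  rw [ENNReal.ofReal_mul (by positivity)]
  refine le_trans ?_ (mul_le_mul_right (lintegral_exp_sq_le_of_tail hY hc h) _)
  rw [← lintegral_const_mul' _ _ ENNReal.ofReal_ne_top]
  refine lintegral_mono fun ω => ?_
  rw [← ENNReal.ofReal_mul (by positivity)]
  refine ENNReal.ofReal_le_ofReal ?_
  have := Real.add_one_le_exp (c / 2 * Y ω ^ 2)
  calc Y ω ^ 2 = 2 / c * (c / 2 * Y ω ^ 2) := by field_simp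
    _ ≤ _ := by gcongr; linarith

theorem memLp_two_of_tail {Y : Ω → ℝ} (hY : Measurable Y) {C c : ℝ} (hc : 0 < c)
    (h : ∀ t : ℝ, 0 < t → P.real {ω | t < |Y ω|} ≤ C * Real.exp (-c * t ^ 2)) :
    MemLp Y 2 P := by
  rw [memLp_two_iff_integrable_sq hY.aestronglyMeasurable]
  refine ⟨(hY.pow_const 2).aestronglyMeasurable, ?_⟩
  rw [hasFiniteIntegral_iff_ofReal (Eventually.of_forall fun ω => sq_nonneg _)]
  exact (lintegral_sq_le_of_tail hY hc h).trans_lt ENNReal.ofReal_lt_top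

/-- A centered random variable with subgaussian concentration around some number `m` has an
exponential square moment. -/
theorem lintegral_exp_sq_le_of_centered {Y : Ω → ℝ} (hY : Measurable Y) {C c m : ℝ} (hc : 0 < c)
    (h : ∀ t : ℝ, 0 < t → P.real {ω | t < |Y ω - m|} ≤ C * Real.exp (-c * t ^ 2))
    (h0 : ∫ ω, Y ω ∂P = 0) :
    ∫⁻ ω, ENNReal.ofReal (Real.exp (c / (4 * (1 + C)) * Y ω ^ 2)) ∂P ≤
      ENNReal.ofReal (Real.exp 1 * (1 + C)) := by
  have hC : 0 ≤ C := by
    have h1 := measureReal_nonneg.trans (h 1 one_pos)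
    exact nonneg_of_mul_nonneg_left h1 (Real.exp_pos _)
  have hYm : Measurable fun ω => Y ω - m := hY.sub_const m
  have hL := memLp_two_of_tail hYm hc h
  have hYi : Integrable Y P :=
    ((hL.integrable (by norm_num)).add (integrable_const m)).congr
      (Eventually.of_forall fun ω => by simp)
  -- Since `Y` is centered, `m²` is at most the second moment of `Y - m`, so the unspecified center
  -- is small.
  have hm : m ^ 2 ≤ 2 / c * (1 + C) := by
    have h1 := sq_integral_le_integral_sq hL
    rw [integral_sub hYi (integrable_const m), h0] at h1
    simp only [integral_const, probReal_univ, one_smul, zero_sub, neg_sq] at h1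
    refine h1.trans ?_
    rw [← ENNReal.ofReal_le_ofReal_iff (by positivity), ofReal_integral_eq_lintegral_ofReal
      hL.integrable_sq (Eventually.of_forall fun ω => sq_nonneg _)]
    exact lintegral_sq_le_of_tail hYm hc h
  rw [ENNReal.ofReal_mul (Real.exp_pos 1).le]
  refine le_trans ?_ (mul_le_mul_right (lintegral_exp_sq_le_of_tail hYm hc h) _)
  rw [← lintegral_const_mul' _ _ ENNReal.ofReal_ne_top]
  refine lintegral_mono fun ω => ?_
  rw [← ENNReal.ofReal_mul (Real.exp_pos 1).le, ← Real.exp_add]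
  refine ENNReal.ofReal_le_ofReal (Real.exp_le_exp.2 ?_)
  -- From `Y² ≤ 2m² + 2(Y - m)²`: the rate `c / (4(1 + C))` makes the first part cost at most a
  -- factor `e` and leaves at most the rate `c/2` for the second.
  have hl : c / (4 * (1 + C)) * (2 * m ^ 2) ≤ 1 := by
    calc c / (4 * (1 + C)) * (2 * m ^ 2) ≤ c / (4 * (1 + C)) * (2 * (2 / c * (1 + C))) := by gcongr
      _ = 1 := by field_simp; norm_num
  have hl2 : c / (4 * (1 + C)) ≤ c / 4 := by
    gcongr; linarith
  have hY2 : Y ω ^ 2 ≤ 2 * m ^ 2 + 2 * (Y ω - m) ^ 2 := by nlinarith [sq_nonneg (Y ω - 2 * m)]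
  have hl0 : 0 < c / (4 * (1 + C)) := by positivity
  calc c / (4 * (1 + C)) * Y ω ^ 2
      ≤ c / (4 * (1 + C)) * (2 * m ^ 2) + c / (4 * (1 + C)) * (2 * (Y ω - m) ^ 2) := by
        rw [← mul_add]; gcongr
    _ ≤ 1 + c / 4 * (2 * (Y ω - m) ^ 2) := by gcongr
    _ = _ := by ring

end Subgaussian

/-! ### Moments of linear forms of a design vector. -/

section Directional

variable {Ω : Type*} [MeasurableSpace Ω] {P : Measure Ω} {p : ℕ}

/-- Conditioning on `V` by Tonelli: a bound for each frozen value may be integrated. -/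
theorem lintegral_le_of_indepFun [IsProbabilityMeasure P] {α β : Type*} [MeasurableSpace α]
    [MeasurableSpace β] {X : Ω → α} {V : Ω → β} (hX : Measurable X) (hV : Measurable V)
    (hXV : IndepFun X V P) {G : α × β → ℝ≥0∞} (hG : Measurable G) {B : β → ℝ≥0∞}
    (hB : Measurable B) (h : ∀ v, ∫⁻ ω, G (X ω, v) ∂P ≤ B v) :
    ∫⁻ ω, G (X ω, V ω) ∂P ≤ ∫⁻ ω, B (V ω) ∂P := by
  have hpair := hXV.map_prod_eq_prod_map_map hX.aemeasurable hV.aemeasurable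
  have : IsProbabilityMeasure (P.map X) := Measure.isProbabilityMeasure_map hX.aemeasurable
  have : IsProbabilityMeasure (P.map V) := Measure.isProbabilityMeasure_map hV.aemeasurable
  rw [← lintegral_map hG (hX.prodMk hV), hpair, lintegral_prod_symm' _ hG, ← lintegral_map hB hV]
  refine lintegral_mono fun v => ?_
  have hGv : Measurable fun x => G (x, v) := hG.comp measurable_prodMk_right
  rw [lintegral_map hGv hX]
  exact h v

/-- All linear forms of `X` in directions of norm at most one have exponential square moments. -/
def HasExpSqMoments (P : Measure Ω) (X : Ω → EuclideanSpace ℝ (Fin p)) (l D : ℝ) : Prop :=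
  ∀ u : EuclideanSpace ℝ (Fin p), ‖u‖ ≤ 1 →
    ∫⁻ ω, ENNReal.ofReal (Real.exp (l * inner ℝ (X ω) u ^ 2)) ∂P ≤ ENNReal.ofReal D

/-- The form `⟨·, u⟩` is convex, and `1`-Lipschitz when `‖u‖ ≤ 1`; its mean is zero because the
coordinates of `X` are centered. -/
theorem ConvexConcentration.hasExpSqMoments [IsProbabilityMeasure P] {X : Ω → EuclideanSpace ℝ (Fin p)}
    (hX : Measurable X) {C c : ℝ} (hc : 0 < c) (h : ConvexConcentration P X C c)
    (h0 : ∀ j, ∫ ω, X ω j ∂P = 0) :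
    HasExpSqMoments P X (c / (4 * (1 + C))) (Real.exp 1 * (1 + C)) := by
  have hconc : ∀ u : EuclideanSpace ℝ (Fin p), ‖u‖ ≤ 1 → ∃ m : ℝ, ∀ t : ℝ, 0 < t →
      P.real {ω | t < |inner ℝ (X ω) u - m|} ≤ C * Real.exp (-c * t ^ 2) := fun u hu => by
    refine h (fun x => inner ℝ x u) ?_ ?_
    · refine LipschitzWith.of_dist_le_mul fun x y => ?_
      rw [Real.dist_eq, ← inner_sub_left, NNReal.coe_one, one_mul, dist_eq_norm]
      exact (abs_real_inner_le_norm _ _).trans (mul_le_of_le_one_right (norm_nonneg _) hu)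
    · refine ⟨convex_univ, fun x _ y _ a b _ _ _ => le_of_eq ?_⟩
      simp [inner_add_left, inner_smul_left]
  have hmeas : ∀ u, Measurable fun ω => (inner ℝ (X ω) u : ℝ) := fun u => hX.inner_const
  have hcoord : ∀ j, Integrable (fun ω => X ω j) P := fun j => by
    obtain ⟨m, hm⟩ := hconc (EuclideanSpace.single j 1) (by simp)
    have h1 := ((memLp_two_of_tail ((hmeas _).sub_const m) hc hm).integrable (by norm_num)).add
      (integrable_const m)
    exact h1.congr (Eventually.of_forall fun ω => by simp [EuclideanSpace.inner_single_right])
  intro u hu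
  obtain ⟨m, hm⟩ := hconc u hu
  refine lintegral_exp_sq_le_of_centered (hmeas u) hc hm ?_
  simp only [PiLp.inner_apply, RCLike.inner_apply, RCLike.conj_to_real]
  rw [integral_finsetSum _ fun j _ => (hcoord j).const_mul _]
  simp [integral_const_mul, h0]

/-- Normalize `v` and use `x^k / k! ≤ exp x`. Only `‖v‖` enters, not the dimension. -/
theorem HasExpSqMoments.lintegral_inner_pow_le {X : Ω → EuclideanSpace ℝ (Fin p)} {l D : ℝ}
    (hl : 0 < l) (h : HasExpSqMoments P X l D) (k : ℕ) (v : EuclideanSpace ℝ (Fin p)) :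
    ∫⁻ ω, ENNReal.ofReal ((inner ℝ (X ω) v ^ 2) ^ k) ∂P ≤
      ENNReal.ofReal (k.factorial * (l⁻¹ ^ k * (‖v‖ ^ 2) ^ k)) * ENNReal.ofReal D := by
  set u := ‖v‖⁻¹ • v with hu
  have hun : ‖u‖ ≤ 1 := by
    rw [hu, norm_smul, norm_inv, norm_norm]
    exact inv_mul_le_one
  have hv : v = ‖v‖ • u := by
    rcases eq_or_ne v 0 with rfl | h0
    · simp
    · rw [hu, smul_smul, mul_inv_cancel₀ (norm_ne_zero_iff.2 h0), one_smul]
  refine le_trans ?_ (mul_le_mul_right (h u hun) _)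
  rw [← lintegral_const_mul' _ _ ENNReal.ofReal_ne_top]
  refine lintegral_mono fun ω => ?_
  rw [← ENNReal.ofReal_mul (by positivity)]
  refine ENNReal.ofReal_le_ofReal ?_
  have h1 := Real.pow_div_factorial_le_exp (x := l * inner ℝ (X ω) u ^ 2) (by positivity) k
  rw [div_le_iff₀ (by positivity)] at h1
  nth_rewrite 1 [hv]
  rw [real_inner_smul_right]
  calc ((‖v‖ * inner ℝ (X ω) u) ^ 2) ^ k
      = l⁻¹ ^ k * (‖v‖ ^ 2) ^ k * (l * inner ℝ (X ω) u ^ 2) ^ k := by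
        rw [← mul_pow, ← mul_pow]
        congr 1
        field_simp
    _ ≤ l⁻¹ ^ k * (‖v‖ ^ 2) ^ k * (Real.exp (l * inner ℝ (X ω) u ^ 2) * k.factorial) := by gcongr
    _ = _ := by ring

theorem HasExpSqMoments.lintegral_inner_pow_le_of_indepFun [IsProbabilityMeasure P]
    {X V : Ω → EuclideanSpace ℝ (Fin p)} {l D : ℝ} (hl : 0 < l) (h : HasExpSqMoments P X l D)
    (hX : Measurable X) (hV : Measurable V) (hXV : IndepFun X V P) (k : ℕ) :
    ∫⁻ ω, ENNReal.ofReal ((inner ℝ (X ω) (V ω) ^ 2) ^ k) ∂P ≤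
      ENNReal.ofReal (k.factorial * l⁻¹ ^ k) * ENNReal.ofReal D *
        ∫⁻ ω, ENNReal.ofReal (‖V ω‖ ^ (2 * k)) ∂P := by
  have hG : Measurable fun q : EuclideanSpace ℝ (Fin p) × EuclideanSpace ℝ (Fin p) =>
      ENNReal.ofReal ((inner ℝ q.1 q.2 ^ 2) ^ k) :=
    (((measurable_fst.inner measurable_snd).pow_const 2).pow_const k).ennreal_ofReal
  have hN : Measurable fun v : EuclideanSpace ℝ (Fin p) => ENNReal.ofReal (‖v‖ ^ (2 * k)) :=
    (measurable_norm.pow_const _).ennreal_ofReal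
  have hNV : Measurable fun ω => ENNReal.ofReal (‖V ω‖ ^ (2 * k)) := hN.comp hV
  rw [← lintegral_const_mul _ hNV]
  refine lintegral_le_of_indepFun hX hV hXV hG (hN.const_mul _) fun v => ?_
  refine (h.lintegral_inner_pow_le hl k v).trans (le_of_eq ?_)
  rw [← mul_assoc, ENNReal.ofReal_mul (by positivity), ← pow_mul]
  ring

end Directional

/-! ### Operator norm of the design matrix. -/

section DesignNorm

variable {n p : ℕ}

/-- A volume argument in place of a net: a nearly maximal direction stays good on a whole ball, so
the supremum defining `‖A‖` is dominated by an integral over directions, which can be exchanged with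
the expectation. -/
theorem exp_norm_designMap_mul_volume_le (x : Fin n → EuclideanSpace ℝ (Fin p)) {l : ℝ}
    (hl : 0 ≤ l) :
    ENNReal.ofReal (Real.exp (l / 64 * ‖designMap x‖ ^ 2)) *
        volume (Metric.ball (0 : EuclideanSpace ℝ (Fin p)) (1 / 4)) ≤
      ∫⁻ v in Metric.ball (0 : EuclideanSpace ℝ (Fin p)) 1,
        ENNReal.ofReal (Real.exp (l * ‖designMap x v‖ ^ 2)) := by
  set A := designMap x
  -- Norm `1/2` keeps the ball of radius `1/4` about `w` inside the unit ball. On it `‖A v‖ ≥ (3/8 -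
  -- 1/4) ‖A‖ = ‖A‖/8`, whence the factor `1/64`.
  obtain ⟨w, hw, hAw⟩ : ∃ w, ‖w‖ ≤ 1 / 2 ∧ 3 / 8 * ‖A‖ ≤ ‖A w‖ := by
    rcases (norm_nonneg A).eq_or_lt with h0 | h0
    · exact ⟨0, by simp, by simp [← h0]⟩
    · obtain ⟨u, hu, hAu⟩ := A.exists_lt_apply_of_lt_opNorm (show 3 / 4 * ‖A‖ < ‖A‖ by linarith)
      refine ⟨(1 / 2 : ℝ) • u, ?_, ?_⟩
      · rw [norm_smul]; norm_num; linarith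
      · rw [map_smul, norm_smul]; norm_num; linarith
  have hsub : Metric.ball w (1 / 4) ⊆ Metric.ball 0 1 := fun v hv => by
    rw [mem_ball_iff_norm] at hv
    rw [mem_ball_zero_iff]
    have := norm_add_le (v - w) w
    rw [sub_add_cancel] at this
    linarith
  calc ENNReal.ofReal (Real.exp (l / 64 * ‖A‖ ^ 2)) *
        volume (Metric.ball (0 : EuclideanSpace ℝ (Fin p)) (1 / 4))
      = ∫⁻ _ in Metric.ball w (1 / 4), ENNReal.ofReal (Real.exp (l / 64 * ‖A‖ ^ 2)) := by
        rw [setLIntegral_const, Measure.addHaar_ball_center _ w]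
    _ ≤ ∫⁻ v in Metric.ball w (1 / 4), ENNReal.ofReal (Real.exp (l * ‖A v‖ ^ 2)) := by
        refine setLIntegral_mono' measurableSet_ball fun v hv => ?_
        rw [mem_ball_iff_norm] at hv
        have h1 : ‖A (v - w)‖ ≤ ‖A‖ * (1 / 4) :=
          (A.le_opNorm _).trans (mul_le_mul_of_nonneg_left hv.le (norm_nonneg _))
        have h2 := norm_sub_le (A v) (A (v - w))
        rw [← map_sub, sub_sub_cancel] at h2
        refine ENNReal.ofReal_le_ofReal (Real.exp_le_exp.2 ?_)
        calc l / 64 * ‖A‖ ^ 2 = l * (1 / 8 * ‖A‖) ^ 2 := by ring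
          _ ≤ l * ‖A v‖ ^ 2 := by gcongr; linarith
    _ ≤ _ := lintegral_mono_set hsub

variable {Ω : Type*} [MeasurableSpace Ω] {P : Measure Ω}

theorem lintegral_exp_norm_designMap_apply_le {X : Fin n → Ω → EuclideanSpace ℝ (Fin p)} {l D : ℝ}
    (hX : ∀ i, Measurable (X i)) (hind : iIndepFun X P)
    (h : ∀ i, HasExpSqMoments P (X i) l D) {v : EuclideanSpace ℝ (Fin p)} (hv : ‖v‖ ≤ 1) :
    ∫⁻ ω, ENNReal.ofReal (Real.exp (l * ‖designMap (fun i => X i ω) v‖ ^ 2)) ∂P ≤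
      ENNReal.ofReal D ^ n := by
  have hm : Measurable fun x : EuclideanSpace ℝ (Fin p) =>
      ENNReal.ofReal (Real.exp (l * inner ℝ x v ^ 2)) :=
    (((measurable_id.inner_const.pow_const 2).const_mul l).exp).ennreal_ofReal
  have h1 : ∀ ω, ENNReal.ofReal (Real.exp (l * ‖designMap (fun i => X i ω) v‖ ^ 2)) =
      ∏ i, ENNReal.ofReal (Real.exp (l * inner ℝ (X i ω) v ^ 2)) := fun ω => by
    rw [norm_designMap_sq, Finset.mul_sum, Real.exp_sum,
      ENNReal.ofReal_prod_of_nonneg fun i _ => (Real.exp_pos _).le]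
  simp_rw [h1]
  rw [lintegral_prod_eq_prod_lintegral_of_indepFun Finset.univ
    (fun i ω => ENNReal.ofReal (Real.exp (l * inner ℝ (X i ω) v ^ 2)))
    (hind.comp (fun _ x => ENNReal.ofReal (Real.exp (l * inner ℝ x v ^ 2))) fun _ => hm)
    fun i => hm.comp (hX i)]
  refine (Finset.prod_le_prod' fun i _ => h i v hv).trans ?_
  simp

/-- For a fixed direction the rows are independent, which gives `D^n`; `4^p` is the ratio of the
volumes of the two balls. -/
theorem lintegral_exp_norm_designMap_le [IsProbabilityMeasure P]
    {X : Fin n → Ω → EuclideanSpace ℝ (Fin p)} {l D : ℝ}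
    (hl : 0 ≤ l) (hX : ∀ i, Measurable (X i)) (hind : iIndepFun X P)
    (h : ∀ i, HasExpSqMoments P (X i) l D) :
    ∫⁻ ω, ENNReal.ofReal (Real.exp (l / 64 * ‖designMap fun i => X i ω‖ ^ 2)) ∂P ≤
      ENNReal.ofReal (4 ^ p) * ENNReal.ofReal D ^ n := by
  set B := Metric.ball (0 : EuclideanSpace ℝ (Fin p)) 1 with hB
  have hB0 : volume B ≠ 0 := (Metric.measure_ball_pos volume _ one_pos).ne'
  have hB1 : volume B ≠ ∞ := measure_ball_lt_top.ne
  have hvol : volume (Metric.ball (0 : EuclideanSpace ℝ (Fin p)) (1 / 4)) =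
      ENNReal.ofReal ((1 / 4) ^ p) * volume B := by
    rw [Measure.addHaar_ball_of_pos _ _ (by norm_num), finrank_euclideanSpace_fin]
  have hmeas : Measurable fun ω => ENNReal.ofReal
      (Real.exp (l / 64 * ‖designMap fun i => X i ω‖ ^ 2)) := by
    have hc : Continuous fun x : Fin n → EuclideanSpace ℝ (Fin p) =>
        Real.exp (l / 64 * ‖designMap x‖ ^ 2) :=
      Real.continuous_exp.comp (continuous_const.mul (continuous_designMap.norm.pow 2))
    exact (hc.measurable.comp (measurable_pi_lambda _ hX)).ennreal_ofReal
  have hjoint : Measurable (Function.uncurry fun ω (v : EuclideanSpace ℝ (Fin p)) =>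
      ENNReal.ofReal (Real.exp (l * ‖designMap (fun i => X i ω) v‖ ^ 2))) := by
    simp_rw [norm_designMap_sq]
    refine Measurable.ennreal_ofReal (Measurable.exp (Measurable.const_mul ?_ l))
    exact Finset.measurable_sum _ fun i _ =>
      (((hX i).comp measurable_fst).inner measurable_snd).pow_const 2
  have h1 : (∫⁻ ω, ENNReal.ofReal (Real.exp (l / 64 * ‖designMap fun i => X i ω‖ ^ 2)) ∂P) *
      (ENNReal.ofReal ((1 / 4) ^ p) * volume B) ≤ ENNReal.ofReal D ^ n * volume B := by
    rw [← hvol, ← lintegral_mul_const _ hmeas]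
    calc _ ≤ ∫⁻ ω, (∫⁻ v in B, ENNReal.ofReal
          (Real.exp (l * ‖designMap (fun i => X i ω) v‖ ^ 2))) ∂P :=
          lintegral_mono fun ω => exp_norm_designMap_mul_volume_le _ hl
      _ = ∫⁻ v in B, (∫⁻ ω, ENNReal.ofReal
          (Real.exp (l * ‖designMap (fun i => X i ω) v‖ ^ 2)) ∂P) :=
          lintegral_lintegral_swap hjoint.aemeasurable
      _ ≤ ∫⁻ v in B, ENNReal.ofReal D ^ n :=
          setLIntegral_mono' measurableSet_ball fun v hv =>
            lintegral_exp_norm_designMap_apply_le hX hind h (mem_ball_zero_iff.1 hv).le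
      _ = _ := setLIntegral_const _ _
  rw [← mul_assoc, ENNReal.mul_le_mul_iff_left hB0 hB1] at h1
  calc _ = ENNReal.ofReal (4 ^ p) *
        ((∫⁻ ω, ENNReal.ofReal (Real.exp (l / 64 * ‖designMap fun i => X i ω‖ ^ 2)) ∂P) *
          ENNReal.ofReal ((1 / 4) ^ p)) := by
        rw [mul_comm, mul_assoc, ← ENNReal.ofReal_mul (by positivity), ← mul_pow]
        norm_num
    _ ≤ _ := by gcongr

/-- This is `t ≤ 1 + t^n` with `t = exp(y/n) / B`. It serves as an `n`-th root of an exponential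
moment of size `B^n`. -/
theorem exp_div_le {B y : ℝ} (hB : 0 < B) {n : ℕ} (hn : n ≠ 0) :
    Real.exp (y / n) ≤ B * (1 + Real.exp y / B ^ n) := by
  have hn' : (n : ℝ) ≠ 0 := by exact_mod_cast hn
  have hy : Real.exp y = Real.exp (y / n) ^ n := by
    rw [← Real.exp_nat_mul, mul_div_cancel₀ _ hn']
  rw [hy, ← div_pow, ← div_le_iff₀' hB]
  have h0 : 0 < Real.exp (y / n) / B := by positivity
  rcases le_total (Real.exp (y / n) / B) 1 with h | h
  · have : 0 ≤ (Real.exp (y / n) / B) ^ n := by positivity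
    linarith
  · have := le_self_pow₀ h hn
    linarith

/-- As `p ≤ m n`, the factor `4^p D^n` is at most `(4^m D)^n`, and passing to `‖A‖²/n` takes the
`n`-th root of it. The bound no longer grows exponentially in `n`. -/
theorem lintegral_norm_designMap_pow_le [IsProbabilityMeasure P]
    {X : Fin n → Ω → EuclideanSpace ℝ (Fin p)} {l D : ℝ}
    (hl : 0 < l) (hD : 1 ≤ D) (hX : ∀ i, Measurable (X i)) (hind : iIndepFun X P)
    (h : ∀ i, HasExpSqMoments P (X i) l D) (hn : n ≠ 0) {m : ℕ} (hpm : p ≤ m * n) (k : ℕ) :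
    ∫⁻ ω, ENNReal.ofReal ((‖designMap fun i => X i ω‖ ^ 2 / n) ^ k) ∂P ≤
      ENNReal.ofReal (k.factorial * (64 / l) ^ k * (2 * (4 ^ m * D))) := by
  have hn' : (0 : ℝ) < n := by exact_mod_cast Nat.pos_of_ne_zero hn
  set B : ℝ := 4 ^ m * D with hB
  have hB0 : 0 < B := by positivity
  have hBn : (4 : ℝ) ^ p * D ^ n / B ^ n ≤ 1 := by
    rw [div_le_one (by positivity), hB, mul_pow, ← pow_mul]
    gcongr
    norm_num
  calc ∫⁻ ω, ENNReal.ofReal ((‖designMap fun i => X i ω‖ ^ 2 / n) ^ k) ∂P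
      ≤ ∫⁻ ω, ENNReal.ofReal (k.factorial * (64 / l) ^ k * B) * (1 + ENNReal.ofReal (1 / B ^ n) *
          ENNReal.ofReal (Real.exp (l / 64 * ‖designMap fun i => X i ω‖ ^ 2))) ∂P := by
        refine lintegral_mono fun ω => ?_
        set y := l / 64 * ‖designMap fun i => X i ω‖ ^ 2 with hy
        rw [← ENNReal.ofReal_mul (by positivity), ← ENNReal.ofReal_one,
          ← ENNReal.ofReal_add zero_le_one (by positivity), ← ENNReal.ofReal_mul (by positivity)]
        refine ENNReal.ofReal_le_ofReal ?_
        have h1 := Real.pow_div_factorial_le_exp (x := y / n) (by positivity) k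
        rw [div_le_iff₀ (by positivity)] at h1
        have h2 := exp_div_le (y := y) hB0 hn
        calc (‖designMap fun i => X i ω‖ ^ 2 / n) ^ k = (64 / l) ^ k * (y / n) ^ k := by
              rw [← mul_pow, hy]; congr 1; field_simp
          _ ≤ (64 / l) ^ k * (Real.exp (y / n) * k.factorial) := by gcongr
          _ ≤ (64 / l) ^ k * (B * (1 + Real.exp y / B ^ n) * k.factorial) := by gcongr
          _ = _ := by ring
    _ ≤ ENNReal.ofReal (k.factorial * (64 / l) ^ k * B) * (1 + ENNReal.ofReal (1 / B ^ n) *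
          (ENNReal.ofReal (4 ^ p) * ENNReal.ofReal D ^ n)) := by
        rw [lintegral_const_mul' _ _ ENNReal.ofReal_ne_top, lintegral_add_left measurable_const,
          lintegral_const_mul' _ _ ENNReal.ofReal_ne_top]
        simp only [lintegral_const, measure_univ, mul_one]
        gcongr
        exact lintegral_exp_norm_designMap_le hl.le hX hind h
    _ ≤ ENNReal.ofReal (k.factorial * (64 / l) ^ k * B) * ENNReal.ofReal 2 := by
        rw [← ENNReal.ofReal_pow (by linarith), ← ENNReal.ofReal_mul (by positivity),
          ← ENNReal.ofReal_mul (by positivity), ← ENNReal.ofReal_one,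
          ← ENNReal.ofReal_add zero_le_one (by positivity)]
        refine mul_le_mul_right (ENNReal.ofReal_le_ofReal ?_) _
        rw [one_div_mul_eq_div]
        linarith
    _ = _ := by
        rw [← ENNReal.ofReal_mul (by positivity)]
        congr 1
        ring

end DesignNorm

/-! ### Independence of the pairs, and of one pair from functions of the others. -/

section Independence

variable {Ω : Type*} [MeasurableSpace Ω] {P : Measure Ω} {n : ℕ}
  {α β : Type*} [MeasurableSpace α] [MeasurableSpace β]

theorem iIndepFun_prodMk [IsProbabilityMeasure P] {X : Fin n → Ω → α} {Y : Fin n → Ω → β} (hX : ∀ i, Measurable (X i))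
    (hY : ∀ i, Measurable (Y i)) (hXi : iIndepFun X P) (hYi : iIndepFun Y P)
    (hXY : IndepFun (fun ω i => X i ω) (fun ω i => Y i ω) P) :
    iIndepFun (fun i ω => (X i ω, Y i ω)) P := by
  have hm : ∀ i, Measurable fun ω => (X i ω, Y i ω) := fun i => (hX i).prodMk (hY i)
  rw [iIndepFun_iff_map_fun_eq_pi_map fun i => (hm i).aemeasurable]
  have hXp := fun i => Measure.isProbabilityMeasure_map (μ := P) (hX i).aemeasurable
  have hYp := fun i => Measure.isProbabilityMeasure_map (μ := P) (hY i).aemeasurable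
  have hpair : ∀ i, P.map (fun ω => (X i ω, Y i ω)) = (P.map (X i)).prod (P.map (Y i)) := fun i =>
    (hXY.comp (measurable_pi_apply i) (measurable_pi_apply i)).map_prod_eq_prod_map_map
      (hX i).aemeasurable (hY i).aemeasurable
  simp_rw [hpair]
  have hmp := (measurePreserving_arrowProdEquivProdArrow α β (Fin n) (fun i => P.map (X i))
    (fun i => P.map (Y i))).symm
  have hjoint := hXY.map_prod_eq_prod_map_map (measurable_pi_lambda _ hX).aemeasurable
    (measurable_pi_lambda _ hY).aemeasurable
  rw [hXi.map_fun_eq_pi_map fun i => (hX i).aemeasurable,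
    hYi.map_fun_eq_pi_map fun i => (hY i).aemeasurable] at hjoint
  rw [← hmp.map_eq, ← hjoint, Measure.map_map hmp.measurable
    ((measurable_pi_lambda _ hX).prodMk (measurable_pi_lambda _ hY))]
  rfl

/-- Invariance under updating coordinate `j` to `a` lets `G` be evaluated from the remaining
coordinates, with `a` in the missing place. -/
theorem indepFun_of_comp_update {Z : Fin n → Ω → α} (hZ : ∀ i, Measurable (Z i))
    (hind : iIndepFun Z P) {G : (Fin n → α) → β} (hG : Measurable G) (j : Fin n) (a : α)
    (hGj : ∀ z, G (Function.update z j a) = G z) :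
    IndepFun (Z j) (fun ω => G fun i => Z i ω) P := by
  set S : Finset (Fin n) := Finset.univ.erase j with hS
  have h := hind.indepFun_finset {j} S (by simp [hS]) hZ
  have h1 : Measurable fun y : ({j} : Finset (Fin n)) → α => y ⟨j, Finset.mem_singleton_self j⟩ :=
    measurable_pi_apply _
  have h2 : Measurable fun y : S → α => G fun i => if hi : i ∈ S then y ⟨i, hi⟩ else a := by
    refine hG.comp (measurable_pi_lambda _ fun i => ?_)
    by_cases hi : i ∈ S
    · simp only [hi, dite_true]; exact measurable_pi_apply _
    · simp only [hi, dite_false]; exact measurable_const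
  refine (h.comp h1 h2).congr (ae_of_all _ fun ω => rfl) (ae_of_all _ fun ω => ?_)
  simp only [Function.comp]
  rw [← hGj fun i => Z i ω]
  congr 1
  funext i
  rcases eq_or_ne i j with rfl | hi
  · simp [hS]
  · simp [hS, hi]

end Independence

/-! ### The assumptions as polylogarithmic moment bounds. -/

section Arrays

variable {Ω : ℕ → Type*} [∀ n, MeasurableSpace (Ω n)] {P : ∀ n, Measure (Ω n)}
  {p : ℕ → ℕ} {ι : ℕ → Type}

theorem IsPolylog.of_rpow (K b : ℝ) :
    IsPolylog fun n (_ : ι n) => ENNReal.ofReal (K * Real.log n ^ b) := by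
  refine ⟨⌈b⌉₊, |K|, ?_⟩
  filter_upwards [eventually_one_le_log] with n hn i
  refine ENNReal.ofReal_le_ofReal ?_
  have h0 : 0 ≤ Real.log n := by linarith
  calc K * Real.log n ^ b ≤ |K| * Real.log n ^ b :=
        mul_le_mul_of_nonneg_right (le_abs_self K) (Real.rpow_nonneg h0 b)
    _ ≤ |K| * Real.log n ^ ((⌈b⌉₊ : ℕ) : ℝ) :=
        mul_le_mul_of_nonneg_left (Real.rpow_le_rpow_of_exponent_le hn (Nat.le_ceil b))
          (abs_nonneg K)
    _ = _ := by rw [Real.rpow_natCast]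

theorem IsPolylog.of_isBigO {u : ℕ → ℝ} {b : ℝ}
    (h : u =O[atTop] fun n : ℕ => Real.log n ^ b) :
    IsPolylog fun n (_ : ι n) => ENNReal.ofReal |u n| := by
  obtain ⟨K, hK⟩ := h.bound
  refine (IsPolylog.of_rpow K b).mono ?_
  filter_upwards [hK, eventually_one_le_log] with n hn h1 i
  rw [Real.norm_eq_abs, Real.norm_of_nonneg (Real.rpow_nonneg (by linarith) b)] at hn
  exact ENNReal.ofReal_le_ofReal hn

theorem ErrorAssumptions.hasPolylogMoments {ρ : ℝ → ℝ} {ε : ∀ n, Fin n → Ω n → ℝ}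
    (hε : ErrorAssumptions P ρ ε) [∀ n, IsProbabilityMeasure (P n)] :
    HasPolylogMoments P ε := by
  refine ⟨hε.measurable, fun k => ?_⟩
  -- `eLpNorm` with exponent `0` is zero by convention and carries no information, so `k = 0` is
  -- treated apart.
  rcases k.eq_zero_or_pos with rfl | hk
  · exact (IsPolylog.const 1).mono (Eventually.of_forall fun n i => by simp)
  obtain ⟨b, hb⟩ := hε.sup_polylog
  obtain ⟨K, hK⟩ := hb k
  refine ((IsPolylog.of_rpow K b).pow k).mono ?_
  filter_upwards [hK] with n hn i
  refine le_trans ?_ (pow_le_pow_left' hn k)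
  have h1 := eLpNorm_nnreal_pow_eq_lintegral (μ := P n) (p := k)
    (f := fun ω => ⨆ i, |ε n i ω|) (by exact_mod_cast hk.ne')
  simp only [NNReal.coe_natCast, ENNReal.rpow_natCast, ENNReal.coe_natCast] at h1
  rw [h1]
  refine lintegral_mono fun ω => ?_
  rw [ENNReal.ofReal_pow (abs_nonneg _), ← ofReal_norm]
  refine pow_le_pow_left' (ENNReal.ofReal_le_ofReal ?_) k
  exact (le_ciSup (f := fun i => |ε n i ω|) (Set.finite_range _).bddAbove i).trans
    (Real.le_norm_self _)

/-- Uniform exponential square moments of the design vectors, with polylogarithmic constants. -/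
structure ExpSqDesign (P : ∀ n, Measure (Ω n))
    (X : ∀ n, Fin n → Ω n → EuclideanSpace ℝ (Fin (p n))) (l D : ℕ → ℝ) : Prop where
  measurable : ∀ n i, Measurable (X n i)
  indep : ∀ n, iIndepFun (X n) (P n)
  -- For `n = 0` there is no design vector whose concentration would force `C n ≥ 0`, so signs are
  -- claimed only for `n ≠ 0`.
  pos : ∀ n, n ≠ 0 → 0 < l n
  one_le : ∀ n, n ≠ 0 → 1 ≤ D n
  moments : ∀ n i, HasExpSqMoments (P n) (X n i) (l n) (D n)
  inv_polylog : ∀ ι : ℕ → Type, IsPolylog fun n (_ : ι n) => ENNReal.ofReal (l n)⁻¹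
  polylog : ∀ ι : ℕ → Type, IsPolylog fun n (_ : ι n) => ENNReal.ofReal (D n)

variable {X : ∀ n, Fin n → Ω n → EuclideanSpace ℝ (Fin (p n))}

theorem DesignAssumptions.expSqDesign [∀ n, IsProbabilityMeasure (P n)] {C c : ℕ → ℝ}
    (h : DesignAssumptions P p X C c) :
    ExpSqDesign P X (fun n => c n / (4 * (1 + C n))) (fun n => Real.exp 1 * (1 + C n)) := by
  have hC : ∀ n, n ≠ 0 → 0 ≤ C n := fun n hn => by
    obtain ⟨m, hm⟩ := h.concentration n ⟨0, Nat.pos_of_ne_zero hn⟩ (fun _ => 0)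
      (LipschitzWith.const' 0) (convexOn_const 0 convex_univ)
    exact nonneg_of_mul_nonneg_left (measureReal_nonneg.trans (hm 1 one_pos)) (Real.exp_pos _)
  obtain ⟨α, -, hα⟩ := h.c_polylog
  obtain ⟨α', -, hα'⟩ := h.C_polylog
  have hC1 : ∀ ι : ℕ → Type, IsPolylog fun n (_ : ι n) => ENNReal.ofReal (1 + C n) := fun ι =>
    ((IsPolylog.const 1).add (IsPolylog.of_isBigO hα')).mono (Eventually.of_forall fun n i => by
      rw [← ENNReal.ofReal_add zero_le_one (abs_nonneg _)]
      exact ENNReal.ofReal_le_ofReal (by linarith [le_abs_self (C n)]))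
  refine ⟨h.measurable, h.indep, fun n hn => ?_, fun n hn => ?_, fun n i => ?_, fun ι => ?_,
    fun ι => ?_⟩
  · have := hC n hn
    have := h.c_pos n
    positivity
  · have := hC n hn
    nlinarith [Real.add_one_le_exp 1]
  · exact (h.concentration n i).hasExpSqMoments (h.measurable n i) (h.c_pos n) (h.mean_zero n i)
  · refine (((hC1 ι).const_mul 4).mul (IsPolylog.of_isBigO hα)).mono ?_
    filter_upwards [eventually_ne_atTop 0] with n hn i
    have := hC n hn
    rw [← ENNReal.ofReal_mul (by norm_num), ← ENNReal.ofReal_mul (by positivity), inv_div,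
      div_eq_mul_inv]
    exact ENNReal.ofReal_le_ofReal (mul_le_mul_of_nonneg_left (le_abs_self _) (by positivity))
  · refine ((hC1 ι).const_mul (Real.exp 1)).mono (Eventually.of_forall fun n i => ?_)
    rw [← ENNReal.ofReal_mul (Real.exp_pos 1).le]

namespace ExpSqDesign

variable [∀ n, IsProbabilityMeasure (P n)] {l D : ℕ → ℝ}

/-- The probabilistic core: Cauchy–Schwarz would cost `‖X‖ ≈ √p`, whereas independence of the
coefficients costs only powers of `log n`. -/
theorem hasPolylogMoments_inner (h : ExpSqDesign P X l D) {φ : ∀ n, ι n → Fin n}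
    {V : ∀ n, ι n → Ω n → EuclideanSpace ℝ (Fin (p n))} (hVm : ∀ n i, Measurable (V n i))
    (hV : HasPolylogMoments P fun n i ω => ‖V n i ω‖)
    (hind : ∀ n i, IndepFun (X n (φ n i)) (V n i) (P n)) :
    HasPolylogMoments P fun n i ω => inner ℝ (X n (φ n i) ω) (V n i ω) := by
  refine HasPolylogMoments.of_sq_moments
    (fun n i => (h.measurable n (φ n i)).inner (hVm n i)) fun k => ?_
  refine ((((h.inv_polylog ι).pow k).const_mul k.factorial).mul (h.polylog ι)).mul
    (hV.2 (2 * k)) |>.mono ?_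
  filter_upwards [eventually_ne_atTop 0] with n hn i
  refine ((h.moments n (φ n i)).lintegral_inner_pow_le_of_indepFun (h.pos n hn)
    (h.measurable n _) (hVm n i) (hind n i) k).trans (le_of_eq ?_)
  rw [ENNReal.ofReal_mul (by positivity), ENNReal.ofReal_pow (inv_nonneg.2 (h.pos n hn).le)]
  simp only [abs_norm]

/-- `‖X‖²/n` is `p/n` times the average of the squared coordinates, each of them a linear form in a
fixed unit direction. -/
theorem hasPolylogMoments_norm_sq_div (h : ExpSqDesign P X l D) {M : ℝ}
    (hM : ∀ᶠ n : ℕ in atTop, (p n : ℝ) / n ≤ M) :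
    HasPolylogMoments P fun n (i : Fin n) ω => ‖X n i ω‖ ^ 2 / n := by
  have h0 : HasPolylogMoments P fun n (q : Fin n × Fin (p n)) (_ : Ω n) =>
      ‖(EuclideanSpace.single q.2 (1 : ℝ) : EuclideanSpace ℝ (Fin (p n)))‖ := by
    refine (HasPolylogMoments.const 1).mono (fun _ _ => measurable_const) ?_
    exact Eventually.of_forall fun n q ω => by simp
  have h1 : HasPolylogMoments P fun n (q : Fin n × Fin (p n)) ω =>
      inner ℝ (X n q.1 ω) (EuclideanSpace.single q.2 (1 : ℝ)) :=
    h.hasPolylogMoments_inner (ι := fun n => Fin n × Fin (p n)) (φ := fun n q => q.1)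
      (V := fun n q _ => EuclideanSpace.single q.2 (1 : ℝ)) (fun _ _ => measurable_const) h0
      (fun n q => indepFun_const_right _ _)
  have h2 := h1.pow 2
  have h3 := h2.average (κ := fun n => Fin (p n))
  refine (h3.const_mul M).mono (fun n i => ((h.measurable n i).norm.pow_const 2).div_const _) ?_
  filter_upwards [hM] with n hn i ω
  have hs : ∑ j, (inner ℝ (X n i ω) (EuclideanSpace.single j (1 : ℝ)) : ℝ) ^ 2 =
      ‖X n i ω‖ ^ 2 := by
    rw [EuclideanSpace.norm_sq_eq]
    simp [EuclideanSpace.inner_single_right]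
  simp only [hs, Fintype.card_fin]
  have hM0 : 0 ≤ M := le_trans (by positivity) hn
  rw [abs_of_nonneg (by positivity), abs_of_nonneg (by positivity)]
  rcases (p n).eq_zero_or_pos with h0 | h0
  · have : ‖X n i ω‖ ^ 2 = 0 := by
      rw [← hs]
      have : IsEmpty (Fin (p n)) := by rw [h0]; infer_instance
      simp
    rw [this]
    simp
  · have hp : (0 : ℝ) < p n := by exact_mod_cast h0
    calc ‖X n i ω‖ ^ 2 / n = (p n : ℝ) / n * (1 / (p n : ℝ) * ‖X n i ω‖ ^ 2) := by field_simp
      _ ≤ _ := by gcongr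

theorem hasPolylogMoments_norm_designMap_sq_div (h : ExpSqDesign P X l D) {M : ℝ}
    (hM : ∀ᶠ n : ℕ in atTop, (p n : ℝ) / n ≤ M) :
    HasPolylogMoments P fun n (_ : ι n) ω => ‖designMap fun i => X n i ω‖ ^ 2 / n := by
  refine ⟨fun n i => ?_, fun k => ?_⟩
  · exact ((continuous_designMap.norm.measurable.comp
      (measurable_pi_lambda _ (h.measurable n))).pow_const 2).div_const _
  refine ((((h.inv_polylog ι).const_mul 64).pow k).const_mul k.factorial |>.mul
    ((h.polylog ι).const_mul (2 * 4 ^ ⌈M⌉₊))).mono ?_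
  filter_upwards [hM, eventually_ne_atTop 0] with n hn h0 i
  have hl := h.pos n h0
  have hD := h.one_le n h0
  have hn0 : (0 : ℝ) < n := by exact_mod_cast Nat.pos_of_ne_zero h0
  have hpm : p n ≤ ⌈M⌉₊ * n := by
    rw [div_le_iff₀ hn0] at hn
    exact_mod_cast hn.trans (mul_le_mul_of_nonneg_right (Nat.le_ceil M) hn0.le)
  have h1 := lintegral_norm_designMap_pow_le hl hD (h.measurable n) (h.indep n) (h.moments n) h0
    hpm k
  have habs : ∀ ω, |‖designMap fun i => X n i ω‖ ^ 2 / (n : ℝ)| =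
      ‖designMap fun i => X n i ω‖ ^ 2 / n := fun ω => abs_of_nonneg (by positivity)
  simp_rw [habs]
  refine h1.trans (le_of_eq ?_)
  rw [← ENNReal.ofReal_mul (by norm_num), ← ENNReal.ofReal_pow (by positivity),
    ← ENNReal.ofReal_mul (by positivity), ← ENNReal.ofReal_mul (by positivity),
    ← ENNReal.ofReal_mul (by positivity)]
  congr 1
  ring

end ExpSqDesign

end Arrays

/-! ### The effect of one deletion on the squared norm. -/

section LeaveOneOut

variable {n p : ℕ} {ρ : ℝ → ℝ} {τ : ℝ}

theorem inner_ridgeHessian_comm (z : Fin n → EuclideanSpace ℝ (Fin p) × ℝ)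
    (b u v : EuclideanSpace ℝ (Fin p)) :
    inner ℝ (ridgeHessian ρ τ z b u) v = inner ℝ u (ridgeHessian ρ τ z b v) := by
  simp only [ridgeHessian_apply, inner_add_left, inner_add_right, real_inner_smul_left,
    real_inner_smul_right, sum_inner, inner_sum]
  congr 2
  refine Finset.sum_congr rfl fun j _ => ?_
  rw [real_inner_comm u]
  ring

/-- Symmetry of the inverse Hessian moves it off the deleted vector `Xᵢ`, leaving linear forms in
`Xᵢ` whose coefficients come from the other observations. -/
theorem inner_inverseHessian_comm (hρ : LossAssumptions ρ) (hτ : 0 < τ)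
    (z : Fin n → EuclideanSpace ℝ (Fin p) × ℝ) (u v : EuclideanSpace ℝ (Fin p)) :
    inner ℝ u (inverseHessian ρ τ z v) = inner ℝ v (inverseHessian ρ τ z u) := by
  have h := inner_ridgeHessian_comm (ρ := ρ) (τ := τ) z (sampleEstimator ρ τ z)
    (inverseHessian ρ τ z u) (inverseHessian ρ τ z v)
  rw [ridgeHessian_inverseHessian hρ hτ, ridgeHessian_inverseHessian hρ hτ] at h
  rw [h, real_inner_comm]

theorem norm_sampleEstimator_sq_le (hρ : LossAssumptions ρ) (hτ : 0 < τ) {K : ℝ} {q : ℕ}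
    (hK0 : 0 ≤ K) (hK : ∀ x, |deriv ρ x| ≤ K * (1 + |x|) ^ q)
    (y : Fin n → EuclideanSpace ℝ (Fin p) × ℝ) {e : Fin n → ℝ} (he : ∀ j, |(y j).2| ≤ |e j|) :
    ‖sampleEstimator ρ τ y‖ ^ 2 ≤
      2 / τ * ((1 / (n : ℝ)) * ∑ j, |e j| * (K * (1 + |e j|) ^ q)) := by
  have h := mul_norm_sampleEstimator_sq_le hρ hτ y
  have h2 : (1 / (n : ℝ)) * ∑ j, ρ (y j).2 ≤
      (1 / (n : ℝ)) * ∑ j, |e j| * (K * (1 + |e j|) ^ q) := by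
    refine mul_le_mul_of_nonneg_left (Finset.sum_le_sum fun j _ => ?_) (by positivity)
    calc ρ (y j).2 ≤ |(y j).2| * |deriv ρ (y j).2| := by
          rw [← abs_mul]; exact (hρ.le_mul_deriv _).trans (le_abs_self _)
      _ ≤ |(y j).2| * (K * (1 + |(y j).2|) ^ q) := by gcongr; exact hK _
      _ ≤ _ := by
          have := he j
          gcongr
  calc ‖sampleEstimator ρ τ y‖ ^ 2 = 2 / τ * (τ / 2 * ‖sampleEstimator ρ τ y‖ ^ 2) := by field_simp
    _ ≤ _ := mul_le_mul_of_nonneg_left (h.trans h2) (by positivity)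

/-- A bound for the effect of deleting observation `i` on `‖β̂‖²`, in terms of quantities that are
linear in the design vector of that observation. -/
theorem mul_abs_norm_sq_sub_norm_sq_le (hρ : LossAssumptions ρ) (hτ : 0 < τ) {K : ℝ} {q : ℕ}
    (hK0 : 0 ≤ K)
    (hK : ∀ r t, |deriv ρ r - deriv ρ (r - t) - deriv (deriv ρ) r * t| ≤
      K * (1 + 2 * |r| + |t|) ^ q * t ^ 2)
    (z y : Fin n → EuclideanSpace ℝ (Fin p) × ℝ) (i : Fin n) (hy : y = Function.update z i 0)
    (S : ℝ) (hS : S = deriv ρ (sampleResidual z (sampleEstimator ρ τ z) i)) (T : Fin n → ℝ)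
    (hT : ∀ j, T j = inner ℝ (z i).1 (inverseHessian ρ τ y ((√n)⁻¹ • (y j).1))) :
    n * |‖sampleEstimator ρ τ z‖ ^ 2 - ‖sampleEstimator ρ τ y‖ ^ 2| ≤
      2 * |S| * |inner ℝ (z i).1 (inverseHessian ρ τ y (sampleEstimator ρ τ y))| +
      2 * ‖sampleEstimator ρ τ y‖ * (1 + τ⁻¹ ^ 2 * (‖designMap fun j => (z j).1‖ ^ 2 / n *
        ((1 / (n : ℝ)) * ∑ j, (K * (1 + 2 * |sampleResidual y (sampleEstimator ρ τ y) j| +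
          |S * T j|) ^ q * (S * T j) ^ 2) ^ 2))) +
      τ⁻¹ ^ 2 * (S ^ 2 * (‖(z i).1‖ ^ 2 / n)) := by
  set a := sampleEstimator ρ τ y with ha
  set b := sampleEstimator ρ τ z with hb
  set w := (S / n) • inverseHessian ρ τ y (z i).1 with hw
  set η := a + w - b with hη
  set Q := ‖designMap fun j => (z j).1‖ ^ 2 / (n : ℝ) with hQ
  set M : Fin n → ℝ := fun j => K * (1 + 2 * |sampleResidual y a j| + |S * T j|) ^ q *
    (S * T j) ^ 2 with hM
  have hn : (0 : ℝ) < n := by exact_mod_cast i.pos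
  have hn1 : (1 : ℝ) ≤ n := by exact_mod_cast i.pos
  have hc0 : 0 < √(n : ℝ) := Real.sqrt_pos.2 hn
  have hc1 : 1 ≤ √(n : ℝ) := Real.one_le_sqrt.2 hn1
  have hc2 : √(n : ℝ) ^ 2 = n := Real.sq_sqrt hn.le
  have hexp := norm_sampleEstimator_sub_expansion_sq_le hρ hτ z i w (by rw [hw, hS, hy])
  rw [← hy, ← ha, ← hb, ← hη] at hexp
  -- The residual of `j` moves by `⟨Xⱼ, w⟩ = S Tⱼ / √n`, and the quadratic Taylor remainder turns
  -- this into order `1/n`.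
  have hR : ∀ j, (n * taylorRemainder ρ τ y w j) ^ 2 ≤ M j ^ 2 := fun j => by
    have ht : inner ℝ (y j).1 w = S * T j / √n := by
      rw [hw, hT, map_smul, real_inner_smul_right, real_inner_smul_right,
        inner_inverseHessian_comm hρ hτ]
      field_simp
      rw [hc2]
      ring
    rw [← sq_abs]
    refine pow_le_pow_left₀ (abs_nonneg _) ?_ 2
    rw [abs_mul, abs_of_pos hn]
    have h1 : |taylorRemainder ρ τ y w j| ≤ K * (1 + 2 * |sampleResidual y a j| +
        |S * T j / √n|) ^ q * (S * T j / √n) ^ 2 := by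
      rw [← ht]; exact hK _ _
    have h2 : |S * T j / √n| ≤ |S * T j| := by
      rw [abs_div, abs_of_pos hc0]
      exact div_le_self (abs_nonneg _) hc1
    calc n * |taylorRemainder ρ τ y w j|
        ≤ n * (K * (1 + 2 * |sampleResidual y a j| + |S * T j / √n|) ^ q *
          (S * T j / √n) ^ 2) := by gcongr
      _ = K * (1 + 2 * |sampleResidual y a j| + |S * T j / √n|) ^ q * (S * T j) ^ 2 := by
          rw [div_pow, hc2]; field_simp
      _ ≤ M j := by simp only [hM]; gcongr
  have hη1 : n * ‖η‖ ≤ 1 + τ⁻¹ ^ 2 * (Q * ((1 / (n : ℝ)) * ∑ j, M j ^ 2)) := by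
    have h1 : (n * ‖η‖) ^ 2 ≤ τ⁻¹ ^ 2 * (Q * ((1 / (n : ℝ)) * ∑ j, M j ^ 2)) := by
      calc (n * ‖η‖) ^ 2 = τ⁻¹ ^ 2 * (n ^ 2 * (τ ^ 2 * ‖η‖ ^ 2)) := by field_simp
        _ ≤ τ⁻¹ ^ 2 * (n ^ 2 * (Q * ((1 / (n : ℝ)) * ∑ j, taylorRemainder ρ τ y w j ^ 2))) := by
            gcongr
        _ = τ⁻¹ ^ 2 * (Q * ((1 / (n : ℝ)) * ∑ j, (n * taylorRemainder ρ τ y w j) ^ 2)) := by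
            simp only [mul_pow, ← Finset.mul_sum]; ring
        _ ≤ _ := by
            have := Finset.sum_le_sum fun j (_ : j ∈ Finset.univ) => hR j
            gcongr
    -- The inequality `x ≤ 1 + x²` avoids a square root of the random bound.
    nlinarith [sq_nonneg (n * ‖η‖ - 1)]
  have hba : τ * ‖b - a‖ ≤ |S / n| * ‖(z i).1‖ := by
    have := mul_norm_sampleEstimator_sub_le hρ hτ z i
    rwa [← hb, ← hS, ← hy, ← ha] at this
  have hba2 : n * ‖b - a‖ ^ 2 ≤ τ⁻¹ ^ 2 * (S ^ 2 * (‖(z i).1‖ ^ 2 / n)) := by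
    calc n * ‖b - a‖ ^ 2 = τ⁻¹ ^ 2 * (n * (τ * ‖b - a‖) ^ 2) := by field_simp
      _ ≤ τ⁻¹ ^ 2 * (n * (|S / n| * ‖(z i).1‖) ^ 2) := by gcongr
      _ = _ := by rw [mul_pow, sq_abs]; field_simp
  -- Expand `‖b‖²` about `a` with `b - a = w - η`. The crude bound on `‖b - a‖` enters only squared,
  -- where it has the right order `1/n`.
  have hkey : n * (‖b‖ ^ 2 - ‖a‖ ^ 2) = 2 * S * inner ℝ (z i).1 (inverseHessian ρ τ y a) -
      2 * (n * inner ℝ a η) + n * ‖b - a‖ ^ 2 := by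
    have h1 : ‖b‖ ^ 2 = ‖a‖ ^ 2 + 2 * inner ℝ a (b - a) + ‖b - a‖ ^ 2 := by
      rw [← norm_add_sq_real, add_sub_cancel]
    have h2 : b - a = w - η := by rw [hη]; abel
    have h3 : inner ℝ a (b - a) = S / n * inner ℝ (z i).1 (inverseHessian ρ τ y a) -
        inner ℝ a η := by
      rw [h2, inner_sub_right, hw, real_inner_smul_right, inner_inverseHessian_comm hρ hτ]
    rw [h1, h3]
    field_simp
    ring
  have haη : |n * inner ℝ a η| ≤ ‖a‖ * (n * ‖η‖) := by
    rw [abs_mul, abs_of_pos hn]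
    have := mul_le_mul_of_nonneg_left (abs_real_inner_le_norm a η) hn.le
    linarith
  calc n * |‖b‖ ^ 2 - ‖a‖ ^ 2| = |n * (‖b‖ ^ 2 - ‖a‖ ^ 2)| := by rw [abs_mul, abs_of_pos hn]
    _ ≤ |2 * S * inner ℝ (z i).1 (inverseHessian ρ τ y a)| + |2 * (n * inner ℝ a η)| +
          |n * ‖b - a‖ ^ 2| := by
        rw [hkey]
        exact (abs_add_le _ _).trans (add_le_add_left (abs_sub _ _) _)
    _ ≤ _ := by
        refine add_le_add (add_le_add (le_of_eq ?_) ?_) ?_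
        · rw [abs_mul, abs_mul, abs_two]
        · rw [abs_mul, abs_two, mul_assoc]
          exact mul_le_mul_of_nonneg_left
            (haη.trans (mul_le_mul_of_nonneg_left hη1 (norm_nonneg _))) (by norm_num)
        · rwa [abs_of_nonneg (by positivity)]

end LeaveOneOut

/-! ### Moment bounds for every term of the deletion estimate. -/

section Assembly

variable {Ω : ℕ → Type*} [∀ n, MeasurableSpace (Ω n)] {P : ∀ n, Measure (Ω n)} {p : ℕ → ℕ} {ρ : ℝ → ℝ} {τ : ℝ}
  {X : ∀ n, Fin n → Ω n → EuclideanSpace ℝ (Fin (p n))} {ε : ∀ n, Fin n → Ω n → ℝ}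
  {l D : ℕ → ℝ} {ι : ℕ → Type}

/-- The sample of pairs (design vector, error). -/
def pairSample (X : ∀ n, Fin n → Ω n → EuclideanSpace ℝ (Fin (p n)))
    (ε : ∀ n, Fin n → Ω n → ℝ) (n : ℕ) (ω : Ω n) : Fin n → EuclideanSpace ℝ (Fin (p n)) × ℝ :=
  fun i => (X n i ω, ε n i ω)

theorem measurable_pairSample (hX : ∀ n i, Measurable (X n i)) (hε : ∀ n i, Measurable (ε n i))
    (n : ℕ) : Measurable (pairSample X ε n) :=
  measurable_pi_lambda _ fun i => (hX n i).prodMk (hε n i)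

theorem hasPolylogMoments_norm_sampleEstimator_sq [∀ n, IsProbabilityMeasure (P n)]
    (hρ : LossAssumptions ρ) (hτ : 0 < τ)
    (hε : HasPolylogMoments P ε) {W : ∀ n, ι n → Ω n → Fin n → EuclideanSpace ℝ (Fin (p n)) × ℝ}
    (hWm : ∀ n i, Measurable (W n i)) (hW : ∀ n i ω j, |(W n i ω j).2| ≤ |ε n j ω|) :
    HasPolylogMoments P fun n i ω => ‖sampleEstimator ρ τ (W n i ω)‖ ^ 2 := by
  obtain ⟨K, hK0, q, hK⟩ := hρ.exists_abs_deriv_le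
  have h1 : HasPolylogMoments P fun n (r : ι n × Fin n) ω =>
      |ε n r.2 ω| * (K * (1 + |ε n r.2 ω|) ^ q) := by
    have he := (hε.comp (κ := fun n => ι n × Fin n) fun n r => r.2).abs
    exact he.mul ((((HasPolylogMoments.const 1).add he).pow q).const_mul K)
  have h2 := h1.average (κ := fun n => Fin n)
  refine (h2.const_mul (2 / τ)).mono (fun n i =>
    ((continuous_sampleEstimator hρ hτ).norm.measurable.comp (hWm n i)).pow_const 2) ?_
  refine Eventually.of_forall fun n i ω => ?_
  rw [abs_of_nonneg (sq_nonneg _)]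
  refine le_trans ?_ (le_abs_self _)
  simp only [Fintype.card_fin]
  exact norm_sampleEstimator_sq_le hρ hτ hK0 hK (W n i ω) (hW n i ω)

theorem hasPolylogMoments_norm_sampleEstimator [∀ n, IsProbabilityMeasure (P n)]
    (hρ : LossAssumptions ρ) (hτ : 0 < τ)
    (hε : HasPolylogMoments P ε) {W : ∀ n, ι n → Ω n → Fin n → EuclideanSpace ℝ (Fin (p n)) × ℝ}
    (hWm : ∀ n i, Measurable (W n i)) (hW : ∀ n i ω j, |(W n i ω j).2| ≤ |ε n j ω|) :
    HasPolylogMoments P fun n i ω => ‖sampleEstimator ρ τ (W n i ω)‖ := by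
  refine ((HasPolylogMoments.const 1).add
    (hasPolylogMoments_norm_sampleEstimator_sq hρ hτ hε hWm hW)).mono (fun n i =>
    (continuous_sampleEstimator hρ hτ).norm.measurable.comp (hWm n i)) ?_
  refine Eventually.of_forall fun n i ω => ?_
  rw [abs_norm]
  refine le_trans ?_ (le_abs_self _)
  nlinarith [sq_nonneg (‖sampleEstimator ρ τ (W n i ω)‖ - 1)]

/-- Linear forms in the `φ n i`-th design vector whose coefficients depend on the other
observations only. -/
theorem ExpSqDesign.hasPolylogMoments_inner_comp [∀ n, IsProbabilityMeasure (P n)]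
    (hX : ExpSqDesign P X l D)
    (hεm : ∀ n i, Measurable (ε n i)) (hZ : ∀ n, iIndepFun (fun i ω => pairSample X ε n ω i) (P n))
    {φ : ∀ n, ι n → Fin n}
    {G : ∀ n, ι n → (Fin n → EuclideanSpace ℝ (Fin (p n)) × ℝ) → EuclideanSpace ℝ (Fin (p n))}
    (hGm : ∀ n i, Measurable (G n i))
    (hG : ∀ n i z, G n i (Function.update z (φ n i) 0) = G n i z)
    (hV : HasPolylogMoments P fun n i ω => ‖G n i (pairSample X ε n ω)‖) :
    HasPolylogMoments P fun n i ω => inner ℝ (X n (φ n i) ω) (G n i (pairSample X ε n ω)) := by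
  refine hX.hasPolylogMoments_inner (φ := φ) (V := fun n i ω => G n i (pairSample X ε n ω))
    (fun n i => (hGm n i).comp (measurable_pairSample hX.measurable hεm n)) hV fun n i => ?_
  have h := indepFun_of_comp_update (fun j => (hX.measurable n j).prodMk (hεm n j)) (hZ n)
    (hGm n i) (φ n i) 0 (hG n i)
  exact h.comp measurable_fst measurable_id

theorem measurable_sampleEstimator (hρ : LossAssumptions ρ) (hτ : 0 < τ) {n p : ℕ} :
    Measurable (sampleEstimator (n := n) (p := p) ρ τ) :=
  (continuous_sampleEstimator hρ hτ).measurable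

theorem continuous_inverseHessian_fst (hρ : LossAssumptions ρ) (hτ : 0 < τ) {n p : ℕ} :
    Continuous fun r : (Fin n → EuclideanSpace ℝ (Fin p) × ℝ) × EuclideanSpace ℝ (Fin p) =>
      inverseHessian ρ τ r.1 :=
  (continuous_inverseHessian (n := n) (p := p) hρ hτ).comp continuous_fst

theorem continuous_inverseHessian_apply (hρ : LossAssumptions ρ) (hτ : 0 < τ) {n p : ℕ} :
    Continuous fun r : (Fin n → EuclideanSpace ℝ (Fin p) × ℝ) × EuclideanSpace ℝ (Fin p) =>
      inverseHessian ρ τ r.1 r.2 :=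
  (continuous_inverseHessian_fst hρ hτ).clm_apply continuous_snd

theorem measurable_inverseHessian_apply (hρ : LossAssumptions ρ) (hτ : 0 < τ) {n p : ℕ}
    {α : Type*} [MeasurableSpace α] {f : α → Fin n → EuclideanSpace ℝ (Fin p) × ℝ}
    {g : α → EuclideanSpace ℝ (Fin p)} (hf : Measurable f) (hg : Measurable g) :
    Measurable fun a => inverseHessian ρ τ (f a) (g a) := by
  have hc := continuous_inverseHessian_apply (n := n) (p := p) hρ hτ
  have h := hc.measurable
  exact h.comp (hf.prodMk hg)

theorem measurable_sampleResidual (hρ : LossAssumptions ρ) (hτ : 0 < τ) {n p : ℕ} (j : Fin n) :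
    Measurable fun z : Fin n → EuclideanSpace ℝ (Fin p) × ℝ =>
      sampleResidual z (sampleEstimator ρ τ z) j :=
  (measurable_pi_apply j).snd.sub
    ((measurable_pi_apply j).fst.inner (measurable_sampleEstimator hρ hτ))

/-- A sample with observation `i` deleted. -/
def deleteObservation {n p : ℕ} (z : Fin n → EuclideanSpace ℝ (Fin p) × ℝ) (i : Fin n) :
    Fin n → EuclideanSpace ℝ (Fin p) × ℝ :=
  Function.update z i 0

theorem measurable_deleteObservation {n p : ℕ} (i : Fin n) :
    Measurable fun z : Fin n → EuclideanSpace ℝ (Fin p) × ℝ => deleteObservation z i :=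
  measurable_update_left

theorem measurable_smul_deleteObservation_fst {n p : ℕ} (c : ℝ) (i j : Fin n) :
    Measurable fun z : Fin n → EuclideanSpace ℝ (Fin p) × ℝ =>
      c • (deleteObservation z i j).1 := by
  have h : Measurable fun z : Fin n → EuclideanSpace ℝ (Fin p) × ℝ =>
      (deleteObservation z i j).1 :=
    ((measurable_pi_apply j).comp (measurable_deleteObservation i)).fst
  exact h.const_smul c

theorem deleteObservation_update {n p : ℕ} (z : Fin n → EuclideanSpace ℝ (Fin p) × ℝ)
    (i : Fin n) : deleteObservation (Function.update z i 0) i = deleteObservation z i :=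
  Function.update_idem _ _ _

theorem deleteObservation_self {n p : ℕ} (z : Fin n → EuclideanSpace ℝ (Fin p) × ℝ)
    (i : Fin n) : deleteObservation z i i = 0 :=
  Function.update_self _ _ _

theorem deleteObservation_of_ne {n p : ℕ} (z : Fin n → EuclideanSpace ℝ (Fin p) × ℝ)
    {i j : Fin n} (h : j ≠ i) : deleteObservation z i j = z j :=
  Function.update_of_ne h _ _

theorem norm_deleteObservation_fst_le {n p : ℕ} (z : Fin n → EuclideanSpace ℝ (Fin p) × ℝ)
    (i j : Fin n) : ‖(deleteObservation z i j).1‖ ≤ ‖(z j).1‖ := by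
  rcases eq_or_ne j i with rfl | h
  · simp [deleteObservation_self]
  · rw [deleteObservation_of_ne z h]

theorem abs_deleteObservation_snd_le {n p : ℕ} (z : Fin n → EuclideanSpace ℝ (Fin p) × ℝ)
    (i j : Fin n) : |(deleteObservation z i j).2| ≤ |(z j).2| := by
  rcases eq_or_ne j i with rfl | h
  · simp [deleteObservation_self]
  · rw [deleteObservation_of_ne z h]

theorem deleteObservation_deleteObservation_update {n p : ℕ}
    (z : Fin n → EuclideanSpace ℝ (Fin p) × ℝ) (i j : Fin n) :
    deleteObservation (deleteObservation (Function.update z j 0) i) j =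
      deleteObservation (deleteObservation z i) j := by
  unfold deleteObservation
  rcases eq_or_ne i j with rfl | h
  · simp only [Function.update_idem]
  · rw [Function.update_comm h, Function.update_idem, Function.update_comm h]

/-- The probabilistic assumptions in the form in which they are used. -/
structure RegressionArray (P : ∀ n, Measure (Ω n)) (ρ : ℝ → ℝ) (τ : ℝ)
    (X : ∀ n, Fin n → Ω n → EuclideanSpace ℝ (Fin (p n))) (ε : ∀ n, Fin n → Ω n → ℝ)
    (l D : ℕ → ℝ) (M : ℝ) : Prop where
  loss : LossAssumptions ρ
  pos : 0 < τ
  design : ExpSqDesign P X l D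
  error : HasPolylogMoments P ε
  indep : ∀ n, iIndepFun (fun i ω => pairSample X ε n ω i) (P n)
  ratio : ∀ᶠ n : ℕ in atTop, (p n : ℝ) / n ≤ M

namespace RegressionArray

variable {M : ℝ}

theorem measurable (h : RegressionArray P ρ τ X ε l D M) (n : ℕ) :
    Measurable (pairSample X ε n) :=
  measurable_pairSample h.design.measurable h.error.measurable n

variable [∀ n, IsProbabilityMeasure (P n)]

theorem norm_estimator_delete (h : RegressionArray P ρ τ X ε l D M) :
    HasPolylogMoments P fun n (i : Fin n) ω =>
      ‖sampleEstimator ρ τ (deleteObservation (pairSample X ε n ω) i)‖ :=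
  hasPolylogMoments_norm_sampleEstimator h.loss h.pos h.error
    (fun n i => (measurable_deleteObservation i).comp (h.measurable n))
    fun _ _ _ _ => abs_deleteObservation_snd_le _ _ _

theorem norm_estimator_delete_delete (h : RegressionArray P ρ τ X ε l D M) :
    HasPolylogMoments P fun n (r : Fin n × Fin n) ω => ‖sampleEstimator ρ τ
      (deleteObservation (deleteObservation (pairSample X ε n ω) r.1) r.2)‖ :=
  hasPolylogMoments_norm_sampleEstimator h.loss h.pos h.error (ι := fun n => Fin n × Fin n)
    (fun n r => (measurable_deleteObservation r.2).comp
      ((measurable_deleteObservation r.1).comp (h.measurable n)))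
    fun _ _ _ _ => (abs_deleteObservation_snd_le _ _ _).trans (abs_deleteObservation_snd_le _ _ _)

theorem inner_estimator_delete (h : RegressionArray P ρ τ X ε l D M) :
    HasPolylogMoments P fun n (i : Fin n) ω => inner ℝ (X n i ω)
      (sampleEstimator ρ τ (deleteObservation (pairSample X ε n ω) i)) :=
  h.design.hasPolylogMoments_inner_comp h.error.measurable h.indep (ι := fun n => Fin n)
    (φ := fun n i => i) (G := fun n i z => sampleEstimator ρ τ (deleteObservation z i))
    (fun n i => (measurable_sampleEstimator h.loss h.pos).comp (measurable_deleteObservation i))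
    (fun n i z => by rw [deleteObservation_update]) h.norm_estimator_delete

theorem inner_estimator_delete_delete (h : RegressionArray P ρ τ X ε l D M) :
    HasPolylogMoments P fun n (r : Fin n × Fin n) ω => inner ℝ (X n r.2 ω)
      (sampleEstimator ρ τ
        (deleteObservation (deleteObservation (pairSample X ε n ω) r.1) r.2)) :=
  h.design.hasPolylogMoments_inner_comp h.error.measurable h.indep (ι := fun n => Fin n × Fin n)
    (φ := fun n r => r.2)
    (G := fun n r z => sampleEstimator ρ τ (deleteObservation (deleteObservation z r.1) r.2))
    (fun n r => (measurable_sampleEstimator h.loss h.pos).comp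
      ((measurable_deleteObservation r.2).comp (measurable_deleteObservation r.1)))
    (fun n r z => by rw [deleteObservation_deleteObservation_update])
    h.norm_estimator_delete_delete

theorem norm_inverseHessian_estimator (h : RegressionArray P ρ τ X ε l D M) :
    HasPolylogMoments P fun n (i : Fin n) ω =>
      ‖inverseHessian ρ τ (deleteObservation (pairSample X ε n ω) i)
        (sampleEstimator ρ τ (deleteObservation (pairSample X ε n ω) i))‖ := by
  have hd : ∀ (n : ℕ) (i : Fin n), Measurable fun ω => deleteObservation (pairSample X ε n ω) i :=
    fun n i => (measurable_deleteObservation i).comp (h.measurable n)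
  refine (h.norm_estimator_delete.const_mul τ⁻¹).mono (fun n i =>
    (measurable_inverseHessian_apply h.loss h.pos (hd n i)
      ((measurable_sampleEstimator h.loss h.pos).comp (hd n i))).norm)
    (Eventually.of_forall fun n i ω => ?_)
  rw [abs_norm, abs_mul, abs_norm, abs_of_pos (inv_pos.2 h.pos), inv_mul_eq_div,
    le_div_iff₀' h.pos]
  exact mul_norm_inverseHessian_le h.loss h.pos _ _

theorem inner_inverseHessian_estimator (h : RegressionArray P ρ τ X ε l D M) :
    HasPolylogMoments P fun n (i : Fin n) ω => inner ℝ (X n i ω)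
      (inverseHessian ρ τ (deleteObservation (pairSample X ε n ω) i)
        (sampleEstimator ρ τ (deleteObservation (pairSample X ε n ω) i))) :=
  h.design.hasPolylogMoments_inner_comp h.error.measurable h.indep (ι := fun n => Fin n)
    (φ := fun n i => i) (G := fun n i z => inverseHessian ρ τ (deleteObservation z i)
      (sampleEstimator ρ τ (deleteObservation z i)))
    (fun n i => measurable_inverseHessian_apply h.loss h.pos (measurable_deleteObservation i)
      ((measurable_sampleEstimator h.loss h.pos).comp (measurable_deleteObservation i)))
    (fun n i z => by rw [deleteObservation_update]) h.norm_inverseHessian_estimator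

/-- The scaling `1/√n` compensates `‖Xⱼ‖ ≈ √p`. The vector depends on `Xⱼ` for `j ≠ i` but never on
the deleted `Xᵢ`, so it is an admissible coefficient for a form in `Xᵢ`. -/
theorem norm_inverseHessian_design (h : RegressionArray P ρ τ X ε l D M) :
    HasPolylogMoments P fun n (r : Fin n × Fin n) ω =>
      ‖inverseHessian ρ τ (deleteObservation (pairSample X ε n ω) r.1)
        ((√n)⁻¹ • (deleteObservation (pairSample X ε n ω) r.1 r.2).1)‖ := by
  have hd : ∀ (n : ℕ) (i : Fin n), Measurable fun ω => deleteObservation (pairSample X ε n ω) i :=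
    fun n i => (measurable_deleteObservation i).comp (h.measurable n)
  have hx := (h.design.hasPolylogMoments_norm_sq_div h.ratio).comp
    (κ := fun n => Fin n × Fin n) fun n r => r.2
  refine (((HasPolylogMoments.const 1).add hx).const_mul τ⁻¹).mono (fun n r =>
    (measurable_inverseHessian_apply h.loss h.pos (hd n r.1)
      ((measurable_smul_deleteObservation_fst _ r.1 r.2).comp (h.measurable n))).norm)
    (Eventually.of_forall fun n r ω => ?_)
  have hn : (0 : ℝ) ≤ n := Nat.cast_nonneg n
  set v := (deleteObservation (pairSample X ε n ω) r.1 r.2).1 with hv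
  have h1 := mul_norm_inverseHessian_le h.loss h.pos
    (deleteObservation (pairSample X ε n ω) r.1) ((√n)⁻¹ • v)
  have h2 : ‖(√n)⁻¹ • v‖ ≤ 1 + ‖X n r.2 ω‖ ^ 2 / n := by
    have h3 : ‖v‖ ≤ ‖X n r.2 ω‖ := norm_deleteObservation_fst_le (pairSample X ε n ω) r.1 r.2
    have h4 : ‖X n r.2 ω‖ ^ 2 / n = ((√n)⁻¹ * ‖X n r.2 ω‖) ^ 2 := by
      rw [mul_pow, inv_pow, Real.sq_sqrt hn]; ring
    rw [norm_smul, norm_inv, Real.norm_of_nonneg (Real.sqrt_nonneg _), h4]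
    have h5 : (√n)⁻¹ * ‖v‖ ≤ (√n)⁻¹ * ‖X n r.2 ω‖ := by gcongr
    nlinarith [sq_nonneg ((√n)⁻¹ * ‖X n r.2 ω‖ - 1)]
  have hτ := h.pos
  rw [abs_norm, abs_of_nonneg (by positivity), inv_mul_eq_div, le_div_iff₀' hτ]
  exact h1.trans h2

theorem inner_inverseHessian_design (h : RegressionArray P ρ τ X ε l D M) :
    HasPolylogMoments P fun n (r : Fin n × Fin n) ω => inner ℝ (X n r.1 ω)
      (inverseHessian ρ τ (deleteObservation (pairSample X ε n ω) r.1)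
        ((√n)⁻¹ • (deleteObservation (pairSample X ε n ω) r.1 r.2).1)) :=
  h.design.hasPolylogMoments_inner_comp h.error.measurable h.indep (ι := fun n => Fin n × Fin n)
    (φ := fun n r => r.1) (G := fun n r z => inverseHessian ρ τ (deleteObservation z r.1)
      ((√n)⁻¹ • (deleteObservation z r.1 r.2).1))
    (fun n r => measurable_inverseHessian_apply h.loss h.pos (measurable_deleteObservation r.1)
      (measurable_smul_deleteObservation_fst _ r.1 r.2))
    (fun n r z => by rw [deleteObservation_update]) h.norm_inverseHessian_design

/-- The estimator without `i` still depends on `Xⱼ`. Deleting `j` as well can only increase the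
`j`-th residual in absolute value and makes it a form in `Xⱼ` with independent coefficients. -/
theorem residual_delete (h : RegressionArray P ρ τ X ε l D M) :
    HasPolylogMoments P fun n (r : Fin n × Fin n) ω =>
      sampleResidual (deleteObservation (pairSample X ε n ω) r.1)
        (sampleEstimator ρ τ (deleteObservation (pairSample X ε n ω) r.1)) r.2 := by
  have he := h.error.comp (κ := fun n => Fin n × Fin n) fun n r => r.2
  refine (he.abs.add h.inner_estimator_delete_delete.abs).mono
    (fun n r => (measurable_sampleResidual h.loss h.pos r.2).comp
      ((measurable_deleteObservation r.1).comp (h.measurable n)))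
    (Eventually.of_forall fun n r ω => ?_)
  refine (abs_sampleResidual_le h.loss h.pos _ _).trans (le_trans ?_ (le_abs_self _))
  rcases eq_or_ne r.2 r.1 with h | h
  · simp only [sampleResidual, h, deleteObservation_self]
    simp only [Prod.snd_zero, Prod.fst_zero, inner_zero_left, sub_zero, abs_zero]
    positivity
  · simp only [sampleResidual, deleteObservation_of_ne _ h]
    exact abs_sub _ _

theorem deriv_residual (h : RegressionArray P ρ τ X ε l D M) :
    HasPolylogMoments P fun n (i : Fin n) ω => deriv ρ (sampleResidual
      (pairSample X ε n ω) (sampleEstimator ρ τ (pairSample X ε n ω)) i) := by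
  obtain ⟨K, hK0, q, hK⟩ := h.loss.exists_abs_deriv_le
  refine ((((HasPolylogMoments.const 1).add
    (h.error.abs.add h.inner_estimator_delete.abs)).pow q).const_mul K).mono
    (fun n i => h.loss.continuous_deriv.measurable.comp
      ((measurable_sampleResidual h.loss h.pos i).comp (h.measurable n)))
    (Eventually.of_forall fun n i ω => ?_)
  refine (hK _).trans (le_trans ?_ (le_abs_self _))
  have h1 := (abs_sampleResidual_le h.loss h.pos (pairSample X ε n ω) i).trans (abs_sub _ _)
  exact mul_le_mul_of_nonneg_left
    (pow_le_pow_left₀ (by positivity) (add_le_add_right h1 1) q) hK0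

/-- Every factor in `mul_abs_norm_sq_sub_norm_sq_le` has polylogarithmic moments, and these are
stable under sums, products and averages over `j`. -/
theorem mul_estimator_sq_sub (h : RegressionArray P ρ τ X ε l D M) :
    HasPolylogMoments P fun n (i : Fin n) ω =>
      n * (‖sampleEstimator ρ τ (pairSample X ε n ω)‖ ^ 2 -
        ‖sampleEstimator ρ τ (deleteObservation (pairSample X ε n ω) i)‖ ^ 2) := by
  obtain ⟨K, hK0, q, hK⟩ := h.loss.exists_abs_deriv_sub_taylor_le
  have hS := h.deriv_residual
  have hx := h.design.hasPolylogMoments_norm_sq_div h.ratio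
  have hST := (hS.comp (κ := fun n => Fin n × Fin n) fun n r => r.1).mul
    h.inner_inverseHessian_design
  have hR := (((((HasPolylogMoments.const 1).add (h.residual_delete.abs.const_mul 2)).add
    hST.abs).pow q).const_mul K).mul (hST.pow 2)
  have hR2 := hR.pow 2
  have hRavg := hR2.average (ι := fun n => Fin n) (κ := fun n => Fin n)
  have hQ := h.design.hasPolylogMoments_norm_designMap_sq_div (ι := fun n => Fin n) h.ratio
  have hfin := (((hS.abs.const_mul 2).mul h.inner_inverseHessian_estimator.abs).add
    ((h.norm_estimator_delete.const_mul 2).mul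
      ((HasPolylogMoments.const 1).add ((hQ.mul hRavg).const_mul (τ⁻¹ ^ 2))))).add
    (((hS.pow 2).mul hx).const_mul (τ⁻¹ ^ 2))
  refine hfin.mono (fun n i => ?_) (Eventually.of_forall fun n i ω => ?_)
  · have hm := measurable_sampleEstimator (n := n) (p := p n) h.loss h.pos
    exact (((hm.comp (h.measurable n)).norm.pow_const 2).sub
      ((hm.comp ((measurable_deleteObservation i).comp (h.measurable n))).norm.pow_const
        2)).const_mul _
  · refine le_trans ?_ (le_abs_self _)
    rw [abs_mul, abs_of_nonneg (Nat.cast_nonneg n)]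
    refine (mul_abs_norm_sq_sub_norm_sq_le h.loss h.pos hK0 hK (pairSample X ε n ω) _ i rfl _ rfl _
      fun j => rfl).trans (le_of_eq ?_)
    simp only [Fintype.card_fin]
    rfl

end RegressionArray

end Assembly

/-! ### Variance bound, convergence in probability and in `L²`. -/

section Conclusion

variable {Ω : ℕ → Type*} [∀ n, MeasurableSpace (Ω n)] {P : ∀ n, Measure (Ω n)}
  {p : ℕ → ℕ} {ρ : ℝ → ℝ} {τ : ℝ}
  {X : ∀ n, Fin n → Ω n → EuclideanSpace ℝ (Fin (p n))} {ε : ∀ n, Fin n → Ω n → ℝ}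
  {l D : ℕ → ℝ} {ι : ℕ → Type}

theorem HasPolylogMoments.eventually_memLp_two {Y : ∀ n, ι n → Ω n → ℝ}
    (h : HasPolylogMoments P Y) : ∀ᶠ n in atTop, ∀ i, MemLp (Y n i) 2 (P n) := by
  obtain ⟨b, K, hb⟩ := h.2 2
  filter_upwards [hb] with n hn i
  rw [memLp_two_iff_integrable_sq (h.1 n i).aestronglyMeasurable]
  refine ⟨((h.1 n i).pow_const 2).aestronglyMeasurable, ?_⟩
  rw [hasFiniteIntegral_iff_ofReal (Eventually.of_forall fun ω => sq_nonneg _)]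
  simp_rw [← sq_abs (Y n i _)]
  exact (hn i).trans_lt ENNReal.ofReal_lt_top

theorem HasPolylogMoments.eventually_integral_sq_le {Y : ∀ n, ι n → Ω n → ℝ}
    (h : HasPolylogMoments P Y) : ∃ b : ℕ, ∃ K : ℝ, 0 ≤ K ∧
      ∀ᶠ n : ℕ in atTop, ∀ i, ∫ ω, Y n i ω ^ 2 ∂(P n) ≤ K * Real.log n ^ b := by
  obtain ⟨b, K, hb⟩ := h.2 2
  refine ⟨b, |K|, abs_nonneg K, ?_⟩
  filter_upwards [hb, h.eventually_memLp_two, eventually_one_le_log] with n hn hm hlog i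
  have h0 : 0 ≤ |K| * Real.log n ^ b := by positivity
  rw [← ENNReal.ofReal_le_ofReal_iff h0, ofReal_integral_eq_lintegral_ofReal (hm i).integrable_sq
    (Eventually.of_forall fun ω => sq_nonneg _)]
  simp_rw [sq_abs] at hn
  exact (hn i).trans (ENNReal.ofReal_le_ofReal
    (mul_le_mul_of_nonneg_right (le_abs_self K) (by positivity)))

namespace RegressionArray

variable [∀ n, IsProbabilityMeasure (P n)] {M : ℝ}

theorem eventually_memLp_estimatorSqNorm (h : RegressionArray P ρ τ X ε l D M) :
    ∀ᶠ n in atTop, MemLp (estimatorSqNorm ρ τ X ε n) 2 (P n) := by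
  have h1 := hasPolylogMoments_norm_sampleEstimator_sq h.loss h.pos h.error (ι := fun _ => Unit)
    (W := fun n _ ω => pairSample X ε n ω) (fun n _ => h.measurable n) fun _ _ _ _ => le_rfl
  filter_upwards [h1.eventually_memLp_two] with n hn
  exact hn ()

/-- Efron–Stein with each pair replaced by `0`: `n` terms, each at most `K (log n)^b / n²`. -/
theorem exists_variance_estimatorSqNorm_le (h : RegressionArray P ρ τ X ε l D M) :
    ∃ b : ℕ, ∃ K : ℝ, ∀ᶠ n : ℕ in atTop,
      variance (estimatorSqNorm ρ τ X ε n) (P n) ≤ K * (Real.log n ^ b / n) := by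
  obtain ⟨b, K, hK0, hK⟩ := h.mul_estimator_sq_sub.eventually_integral_sq_le
  refine ⟨b, K, ?_⟩
  have hdel := h.norm_estimator_delete.pow 2
  filter_upwards [hK, h.eventually_memLp_estimatorSqNorm, hdel.eventually_memLp_two,
    eventually_ne_atTop 0] with n hn hf hg h0
  have hn0 : (0 : ℝ) < n := by exact_mod_cast Nat.pos_of_ne_zero h0
  have hes := variance_le_sum_integral_sq_sub_update (P := P n)
    (Z := fun i ω => pairSample X ε n ω i)
    (fun i => (measurable_pi_apply i).comp (h.measurable n)) (h.indep n)
    (f := fun z => ‖sampleEstimator ρ τ z‖ ^ 2)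
    ((measurable_sampleEstimator h.loss h.pos).norm.pow_const 2) 0 hf hg
  refine hes.trans ?_
  calc ∑ k, ∫ ω, (‖sampleEstimator ρ τ (pairSample X ε n ω)‖ ^ 2 -
        ‖sampleEstimator ρ τ (deleteObservation (pairSample X ε n ω) k)‖ ^ 2) ^ 2 ∂(P n)
      ≤ ∑ _k : Fin n, K * Real.log n ^ b / (n : ℝ) ^ 2 := by
        refine Finset.sum_le_sum fun k _ => ?_
        rw [le_div_iff₀' (by positivity), ← integral_const_mul]
        simpa only [mul_pow] using hn k
    _ = K * (Real.log n ^ b / n) := by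
        rw [Finset.sum_const, Finset.card_univ, Fintype.card_fin, nsmul_eq_mul]
        field_simp

end RegressionArray

theorem tendsto_log_pow_div_natCast (b : ℕ) :
    Tendsto (fun n : ℕ => Real.log n ^ b / (n : ℝ)) atTop (𝓝 0) :=
  ((Real.isLittleO_pow_log_id_atTop (n := b)).tendsto_div_nhds_zero).comp tendsto_natCast_atTop_atTop

theorem eLpNorm_sub_integral_two {Ω : Type*} [MeasurableSpace Ω] {P : Measure Ω}
    [IsFiniteMeasure P] {f : Ω → ℝ} (hf : MemLp f 2 P) :
    eLpNorm (fun ω => f ω - ∫ ω, f ω ∂P) 2 P = ENNReal.ofReal (variance f P) ^ (1 / 2 : ℝ) := by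
  have h := eLpNorm_nnreal_pow_eq_lintegral (μ := P) (p := 2)
    (f := fun ω => f ω - ∫ ω, f ω ∂P) two_ne_zero
  rw [hf.ofReal_variance_eq, evariance]
  simp only [NNReal.coe_ofNat, ENNReal.rpow_ofNat, ENNReal.coe_ofNat] at h
  rw [← h, ← ENNReal.rpow_natCast, ← ENNReal.rpow_mul]
  norm_num

end Conclusion

theorem mainTheorem5 {Ω : ℕ → Type*} [∀ n, MeasurableSpace (Ω n)]
    (P : ∀ n, Measure (Ω n)) [∀ n, IsProbabilityMeasure (P n)]
    (p : ℕ → ℕ) (κ : ℝ) (hκ : 0 < κ)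
    (hp : Tendsto (fun n : ℕ => (p n : ℝ) / (n : ℝ)) atTop (𝓝 κ))
    (ρ : ℝ → ℝ) (hρ : LossAssumptions ρ) (τ : ℝ) (hτ : 0 < τ)
    (X : ∀ n, Fin n → Ω n → EuclideanSpace ℝ (Fin (p n))) (C c : ℕ → ℝ)
    (hX : DesignAssumptions P p X C c)
    (ε : ∀ n, Fin n → Ω n → ℝ) (hε : ErrorAssumptions P ρ ε)
    (hindep : ∀ n, IndepFun (fun ω i => X n i ω) (fun ω i => ε n i ω) (P n)) :
    (∀ᶠ n in atTop, MemLp (estimatorSqNorm ρ τ X ε n) 2 (P n)) ∧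
    Tendsto (fun n => variance (estimatorSqNorm ρ τ X ε n) (P n)) atTop (𝓝 0) ∧
    (∃ a : ℕ → ℝ,
      (∀ δ : ℝ, 0 < δ →
        Tendsto (fun n => (P n) {ω | δ ≤ |estimatorSqNorm ρ τ X ε n ω - a n|}) atTop (𝓝 0)) ∧
      Tendsto (fun n => eLpNorm (fun ω => estimatorSqNorm ρ τ X ε n ω - a n) 2 (P n)) atTop (𝓝 0)) ∧
    (∃ γ : ℝ, (fun n => variance (estimatorSqNorm ρ τ X ε n) (P n)) =O[atTop]
      fun n : ℕ => Real.log n ^ γ / (n : ℝ)) := by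
  -- Any number above `κ` eventually bounds `p n / n`.
  have h : RegressionArray P ρ τ X ε _ _ (κ + 1) :=
    ⟨hρ, hτ, hX.expSqDesign, hε.hasPolylogMoments, fun n => iIndepFun_prodMk (hX.measurable n)
      (hε.measurable n) (hX.indep n) (hε.indep n) (hindep n), hp.eventually_le_const (by linarith)⟩
  have hmem := h.eventually_memLp_estimatorSqNorm
  obtain ⟨b, K, hb⟩ := h.exists_variance_estimatorSqNorm_le
  have hvar : Tendsto (fun n => variance (estimatorSqNorm ρ τ X ε n) (P n)) atTop (𝓝 0) := by
    refine squeeze_zero' (Eventually.of_forall fun n => variance_nonneg _ _) hb ?_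
    simpa using (tendsto_log_pow_div_natCast b).const_mul K
  refine ⟨hmem, hvar, ⟨fun n => ∫ ω, estimatorSqNorm ρ τ X ε n ω ∂(P n), fun δ hδ => ?_, ?_⟩,
    b, ?_⟩
  -- With the mean as deterministic equivalent, Chebyshev's inequality gives convergence in
  -- probability.
  · refine tendsto_of_tendsto_of_tendsto_of_le_of_le' tendsto_const_nhds
      (h := fun n => ENNReal.ofReal (variance (estimatorSqNorm ρ τ X ε n) (P n) / δ ^ 2)) ?_
      (Eventually.of_forall fun n => zero_le) ?_
    · simpa using ENNReal.tendsto_ofReal (hvar.div_const (δ ^ 2))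
    · filter_upwards [hmem] with n hn
      exact meas_ge_le_variance_div_sq hn hδ
  · have h2 := (ENNReal.tendsto_ofReal hvar).ennrpow_const (1 / 2 : ℝ)
    rw [ENNReal.ofReal_zero, ENNReal.zero_rpow_of_pos (by norm_num)] at h2
    refine h2.congr' ?_
    filter_upwards [hmem] with n hn
    exact (eLpNorm_sub_integral_two hn).symm
  · refine IsBigO.of_bound K ?_
    filter_upwards [hb, eventually_one_le_log] with n hn hlog
    rw [Real.norm_of_nonneg (variance_nonneg _ _), Real.rpow_natCast,
      Real.norm_of_nonneg (by positivity)]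
    exact hn
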